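/- Theorem (Suboptimality of PEVI for Linear MDPs). Consider an episodic Markov decision process with (measurable) state space $\mathcal S$, action space $\mathcal A$ and horizon $H$, in which, at step $h\in[H]$, given $(s_h,a_h)=(x,a)$, the reward $r_h(s_h,a_h)\in[0,1]$ and the next state $s_{h+1}$ are drawn from a fixed joint law; write $\mathcal P_h(\cdot\mid x,a)$ for the law of $s_{h+1}$ and $(\mathbb B_h f)(x,a)=\mathbb E[r_h(s_h,a_h)+f(s_{h+1})\mid s_h=x,a_h=a]$ for the Bellman operator. Suppose the MDP is linear: for a known feature map $\phi:\mathcal S\times\mathcal A\to\mathbb R^d$ with $\|\phi(x,a)\|\le1$, there are, for each $h$, an $\mathbb R^d$-valued measure $\mu_h$ on $\mathcal S$ with total variation $\|\mu_h\|(\mathcal S)\le\sqrt d$ (with respect to the Euclidean norm) and a vector $\theta_h\in\mathbb R^d$ with $\|\theta_h\|\le\sqrt d$ such that $\mathcal P_h(B\mid x,a)=\langle\phi(x,a),\mu_h(B)\rangle$ for all measurable $B\subseteq\mathcal S$ and $\mathbb E[r_h(s_h,a_h)\mid s_h=x,a_h=a]=\langle\phi(x,a),\theta_h\rangle$. Let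 $\mathcal D=\{(x_h^\tau,a_h^\tau,r_h^\tau)\}_{\tau,h=1}^{K,H}$, $K\ge1$, together with the final states $x_{H+1}^\tau$, be a random dataset with law $\mathbb P_{\mathcal D}$ that is compliant with the MDP: for all $h\in[H]$, $\tau\in[K]$, the conditional law of $(r_h^\tau,x_{h+1}^\tau)$ given $\{(x_h^j,a_h^j)\}_{j\le\tau}$ and $\{(r_h^j,x_{h+1}^j)\}_{j<\tau}$ is the law of $(r_h(s_h,a_h),s_{h+1})$ given $(s_h,a_h)=(x_h^\tau,a_h^\tau)$. Pessimistic value iteration (PEVI) with parameters $\lambda,\beta$ sets $\hat V_{H+1}=0$ and, for $h=H,\dots,1$, $$\Lambda_h=\sum_{\tau=1}^K\phi(x_h^\tau,a_h^\tau)\phi(x_h^\tau,a_h^\tau)^\top+\lambda I,\qquad \hat w_h=\Lambda_h^{-1}\sum_{\tau=1}^K\phi(x_h^\tau,a_h^\tau)\bigl(r_h^\tau+\hat V_{h+1}(x_{h+1}^\tau)\bigr),$$ $$(\hat{\mathbb B}_h\hat V_{h+1})(x,a)=\phi(x,a)^\top\hat w_h,\qquad \Gamma_h(x,a)=\beta\,\bigl(\phi(x,a)^\top\Lambda_h^{-1}\phi(x,a)\bigr)^{1/2},$$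 $$\hat Q_h=\max\bigl\{\min\{\hat{\mathbb B}_h\hat V_{h+1}-\Gamma_h,\;H-h+1\},\,0\bigr\},$$ lets $\hat\pi_h(\cdot\mid x)$ maximize $\int\hat Q_h(x,a)\,\nu(da)$ over all probability distributions $\nu$ on $\mathcal A$ (assumed attained; ties are broken arbitrarily), and sets $\hat V_h(x)=\int\hat Q_h(x,a)\,\hat\pi_h(da\mid x)$. Its output is $\mathrm{Pess}(\mathcal D)=\{\hat\pi_h\}_{h=1}^H$. For a policy $\pi$ let $V_1^\pi(x)=\mathbb E_\pi[\sum_{h=1}^H r_h(s_h,a_h)\mid s_1=x]$, let $\pi^*$ be an optimal policy, and let $\mathrm{SubOpt}(\pi;x)=V_1^{\pi^*}(x)-V_1^\pi(x)$. There is an absolute constant $c>0$ such that for every such MDP and dataset and every $\xi\in(0,1)$, if PEVI is run with $\lambda=1$ and $\beta=c\,dH\sqrt{\log(2dHK/\xi)}$, then: (i) $\{\Gamma_h\}_{h=1}^H$ is a $\xi$-uncertainty quantifier, that is, the event $$\mathcal E=\Bigl\{\bigl|(\hat{\mathbb B}_h\hat V_{h+1})(x,a)-(\mathbb B_h\hat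 V_{h+1})(x,a)\bigr|\le\Gamma_h(x,a)\ \text{for all }(x,a)\in\mathcal S\times\mathcal A,\ h\in[H]\Bigr\}$$ satisfies $\mathbb P_{\mathcal D}(\mathcal E)\ge1-\xi$; (ii) on $\mathcal E$, simultaneously for all $x\in\mathcal S$, $$\mathrm{SubOpt}(\mathrm{Pess}(\mathcal D);x)\le2\beta\sum_{h=1}^H\mathbb E_{\pi^*}\Bigl[\bigl(\phi(s_h,a_h)^\top\Lambda_h^{-1}\phi(s_h,a_h)\bigr)^{1/2}\Bigm| s_1=x\Bigr],$$ where $\mathbb E_{\pi^*}$ is over the trajectory induced by $\pi^*$ in the MDP, with $\Lambda_h$ held fixed. -/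

import Mathlib

open MeasureTheory ProbabilityTheory
open scoped ENNReal

/-!
Steps of the episode are indexed by `h : Fin H`, so that step `h + 1` of the usual one-based
numbering is `h` here; `Fin (H + 1)` also indexes the terminal time.
-/

/-- An episodic Markov decision process with horizon `H`. `step h (x, a)` is the joint law of the
immediate reward `r_h(s_h, a_h)` and the next state `s_{h+1}` given `s_h = x`, `a_h = a`
(a deterministic reward function is the case of a Dirac first marginal). Rewards are in `[0, 1]`. -/
structure EpisodicMDP (S A : Type*) [MeasurableSpace S] [MeasurableSpace A] (H : ℕ) where
  step : Fin H → Kernel (S × A) (ℝ × S)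
  markov : ∀ h, IsMarkovKernel (step h)
  reward_mem : ∀ h z, ∀ᵐ y ∂(step h z), y.1 ∈ Set.Icc (0 : ℝ) 1

/-- A (randomized Markov) policy: at each step, a Markov kernel from states to actions. -/
structure MDPPolicy (S A : Type*) [MeasurableSpace S] [MeasurableSpace A] (H : ℕ) where
  act : Fin H → Kernel S A
  markov : ∀ h, IsMarkovKernel (act h)

attribute [instance] EpisodicMDP.markov MDPPolicy.markov

/-- `K` trajectories `(x_h, a_h, r_h)`, together with the state observed after the last step. -/
structure OfflineDataset (S A : Type*) (H K : ℕ) where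
  state : Fin K → Fin (H + 1) → S
  action : Fin K → Fin H → A
  reward : Fin K → Fin H → ℝ

noncomputable section

section MDP

variable {S A : Type*} [MeasurableSpace S] [MeasurableSpace A] {H : ℕ}

namespace EpisodicMDP

/-- The transition kernel `P_h(· | x, a)`. -/
def transition (M : EpisodicMDP S A H) (h : Fin H) : Kernel (S × A) S :=
  (M.step h).snd

/-- The expected reward `E[r_h(s_h, a_h) | s_h = x, a_h = a]`. -/
def meanReward (M : EpisodicMDP S A H) (h : Fin H) (z : S × A) : ℝ :=
  ∫ y, y.1 ∂(M.step h z)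

/-- The Bellman operator `(B_h f)(x, a) = E[r_h(s_h, a_h) + f(s_{h+1}) | s_h = x, a_h = a]`. -/
def bellman (M : EpisodicMDP S A H) (h : Fin H) (f : S → ℝ) (z : S × A) : ℝ :=
  ∫ y, (y.1 + f y.2) ∂(M.step h z)

/-- The joint law, for the policy `π` started at `s_1 = x`, of the first `n` triples
`(s_i, a_i, r_i)` and of the state that follows them. -/
def trajPrefix (M : EpisodicMDP S A H) (π : MDPPolicy S A H) (x : S) :
    (n : ℕ) → n ≤ H → Measure ((Fin n → S × A × ℝ) × S)
  | 0, _ => Measure.dirac (Fin.elim0, x)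
  | n + 1, hn =>
      ((trajPrefix M π x n (Nat.le_of_succ_le hn)) ⊗ₘ
        ((π.act ⟨n, hn⟩ ⊗ₖ M.step ⟨n, hn⟩).comap Prod.snd measurable_snd)).map
        (fun p => (Fin.snoc (α := fun _ => S × A × ℝ) p.1.1 (p.1.2, p.2.1, p.2.2.1), p.2.2.2))

/-- The law of the whole trajectory `((s_h, a_h, r_h)_h, s_{H+1})` induced by `π` from
`s_1 = x`. -/
def trajLaw (M : EpisodicMDP S A H) (π : MDPPolicy S A H) (x : S) :
    Measure ((Fin H → S × A × ℝ) × S) :=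
  M.trajPrefix π x H le_rfl

/-- `E_π[f(s_h, a_h) | s_1 = x]`. -/
def expectSA (M : EpisodicMDP S A H) (π : MDPPolicy S A H) (x : S) (h : Fin H)
    (f : S × A → ℝ) : ℝ :=
  ∫ t, f ((t.1 h).1, (t.1 h).2.1) ∂(M.trajLaw π x)

/-- The value `V_1^π(x)`: the expected cumulative reward of `π` from `s_1 = x`. -/
def value (M : EpisodicMDP S A H) (π : MDPPolicy S A H) (x : S) : ℝ :=
  ∫ t, ∑ h, (t.1 h).2.2 ∂(M.trajLaw π x)

/-- `π` is optimal: it maximizes the expected cumulative reward from every initial state. -/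
def IsOptimal (M : EpisodicMDP S A H) (π : MDPPolicy S A H) : Prop :=
  ∀ (π' : MDPPolicy S A H) (x : S), M.value π' x ≤ M.value π x

/-- `SubOpt(π; x) = V_1^{π*}(x) - V_1^π(x)`, where `πstar` is an optimal policy. -/
def subOpt (M : EpisodicMDP S A H) (πstar π : MDPPolicy S A H) (x : S) : ℝ :=
  M.value πstar x - M.value π x

/-- Linear MDP with feature map `φ`: the transition kernel and the mean reward are linear in `φ`.
The `d` signed measures `μ_h` form an `ℝ^d`-valued vector measure, and `‖μ_h(S)‖` is its total
variation with respect to the Euclidean norm (`∫ ‖μ_h(x)‖ dx` when `μ_h` has a density). -/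
def IsLinear {d : ℕ} (M : EpisodicMDP S A H) (φ : S × A → EuclideanSpace ℝ (Fin d)) : Prop :=
  (∀ z, ‖φ z‖ ≤ 1) ∧
  ∃ (μ : Fin H → VectorMeasure S (EuclideanSpace ℝ (Fin d)))
    (θ : Fin H → EuclideanSpace ℝ (Fin d)),
    ∀ h : Fin H,
      (μ h).variation Set.univ ≤ ENNReal.ofReal (Real.sqrt d) ∧
      ‖θ h‖ ≤ Real.sqrt d ∧
      (∀ z, ∀ B : Set S, MeasurableSet B → (M.transition h z).real B = inner ℝ (φ z) (μ h B)) ∧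
      (∀ z, M.meanReward h z = inner ℝ (φ z) (θ h))

end EpisodicMDP

/-- The values of the variables in the conditioning of the `τ`-th trajectory: state-action pairs
of the trajectories `j ≤ τ`, and rewards and next states of the trajectories `j < τ`. -/
abbrev DataHistory (S A : Type*) {K : ℕ} (τ : Fin K) : Type _ :=
  ({j : Fin K // j ≤ τ} → S × A) × ({j : Fin K // j < τ} → ℝ × S)

/-- The current state-action pair `(x_h^τ, a_h^τ)` of a history. -/
def DataHistory.current {S A : Type*} {K : ℕ} {τ : Fin K} (p : DataHistory S A τ) : S × A :=
  p.1 ⟨τ, le_refl τ⟩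

theorem DataHistory.measurable_current {K : ℕ} {τ : Fin K} :
    Measurable (DataHistory.current : DataHistory S A τ → S × A) :=
  (measurable_pi_apply (⟨τ, le_refl τ⟩ : {j : Fin K // j ≤ τ})).comp measurable_fst

/-- The information available just before `(r_h^τ, x_{h+1}^τ)` is revealed:
`(x_h^j, a_h^j)` for `j ≤ τ` and `(r_h^j, x_{h+1}^j)` for `j < τ`. -/
def dataHistory {K : ℕ} (h : Fin H) (τ : Fin K) (D : OfflineDataset S A H K) :
    DataHistory S A τ :=
  (fun j => (D.state j h.castSucc, D.action j h), fun j => (D.reward j h, D.state j h.succ))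

/-- The random dataset `D` is compliant with `M`: conditionally on the history, the pair
`(r_h^τ, x_{h+1}^τ)` has law `M.step h (x_h^τ, a_h^τ)`. -/
def IsCompliant {Ω : Type*} [MeasurableSpace Ω] {K : ℕ} (P : Measure Ω)
    (M : EpisodicMDP S A H) (D : Ω → OfflineDataset S A H K) : Prop :=
  (∀ τ h, Measurable fun ω => (D ω).state τ h) ∧
  (∀ τ h, Measurable fun ω => (D ω).action τ h) ∧
  (∀ τ h, Measurable fun ω => (D ω).reward τ h) ∧
  ∀ (h : Fin H) (τ : Fin K),
    HasCondDistrib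
      (fun ω => ((D ω).reward τ h, (D ω).state τ h.succ))
      (fun ω => dataHistory h τ (D ω))
      ((M.step h).comap DataHistory.current DataHistory.measurable_current)
      P

end MDP

/-! ### Pessimistic value iteration with linear function approximation -/

namespace PEVI

variable {S A : Type*} {H K d : ℕ}

/-- `Λ_h = ∑_τ φ(x_h^τ, a_h^τ) φ(x_h^τ, a_h^τ)ᵀ + lam • I`. -/
def gram (φ : S × A → EuclideanSpace ℝ (Fin d)) (lam : ℝ) (D : OfflineDataset S A H K)
    (h : Fin H) : Matrix (Fin d) (Fin d) ℝ :=
  (∑ τ, Matrix.vecMulVec (φ (D.state τ h.castSucc, D.action τ h)).ofLp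
      (φ (D.state τ h.castSucc, D.action τ h)).ofLp) + lam • (1 : Matrix (Fin d) (Fin d) ℝ)

/-- `(φ(x, a)ᵀ Λ_h⁻¹ φ(x, a))^{1/2}`. -/
def width (φ : S × A → EuclideanSpace ℝ (Fin d)) (lam : ℝ) (D : OfflineDataset S A H K)
    (h : Fin H) (z : S × A) : ℝ :=
  Real.sqrt ((φ z).ofLp ⬝ᵥ ((gram φ lam D h)⁻¹.mulVec (φ z).ofLp))

/-- The penalty `Γ_h(x, a) = β (φ(x, a)ᵀ Λ_h⁻¹ φ(x, a))^{1/2}`. -/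
def penalty (φ : S × A → EuclideanSpace ℝ (Fin d)) (lam β : ℝ) (D : OfflineDataset S A H K)
    (h : Fin H) (z : S × A) : ℝ :=
  β * width φ lam D h z

/-- The ridge regression weights `Λ_h⁻¹ ∑_τ φ(x_h^τ, a_h^τ) (r_h^τ + V(x_{h+1}^τ))`. -/
def weight (φ : S × A → EuclideanSpace ℝ (Fin d)) (lam : ℝ) (D : OfflineDataset S A H K)
    (h : Fin H) (V : S → ℝ) : Fin d → ℝ :=
  (gram φ lam D h)⁻¹.mulVec
    (∑ τ, (D.reward τ h + V (D.state τ h.succ)) •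
      (φ (D.state τ h.castSucc, D.action τ h)).ofLp)

/-- The estimated Bellman update `φ(x, a)ᵀ w`, with `w` the ridge regression weights. -/
def bellmanHat (φ : S × A → EuclideanSpace ℝ (Fin d)) (lam : ℝ) (D : OfflineDataset S A H K)
    (h : Fin H) (V : S → ℝ) (z : S × A) : ℝ :=
  (φ z).ofLp ⬝ᵥ weight φ lam D h V

/-- The pessimistic, truncated Q-function built from the next value function `V`. The number of
remaining steps, `H - h + 1` in one-based numbering, is `H - h` here. -/
def qStep (φ : S × A → EuclideanSpace ℝ (Fin d)) (lam β : ℝ) (D : OfflineDataset S A H K)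
    (h : Fin H) (V : S → ℝ) (z : S × A) : ℝ :=
  max (min (bellmanHat φ lam D h V z - penalty φ lam β D h z) ((H : ℝ) - (h : ℕ))) 0

variable [MeasurableSpace S] [MeasurableSpace A]

/-- The value functions of the algorithm, computed backwards from `0` at the terminal time by
averaging the Q-function over the policy. -/
def vHat (φ : S × A → EuclideanSpace ℝ (Fin d)) (lam β : ℝ) (D : OfflineDataset S A H K)
    (π : MDPPolicy S A H) : Fin (H + 1) → S → ℝ :=
  Fin.reverseInduction (motive := fun _ => S → ℝ) (fun _ => 0)
    (fun h V x => ∫ a, qStep φ lam β D h V (x, a) ∂(π.act h x))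

/-- The Q-function of the algorithm at step `h`. -/
def qHat (φ : S × A → EuclideanSpace ℝ (Fin d)) (lam β : ℝ) (D : OfflineDataset S A H K)
    (π : MDPPolicy S A H) (h : Fin H) : S × A → ℝ :=
  qStep φ lam β D h (vHat φ lam β D π h.succ)

/-- `π` is an output of the algorithm on `D`: at each step and state, `π` maximizes the average of
the Q-function over all distributions on the action space (ties are broken arbitrarily). -/
def IsOutput (φ : S × A → EuclideanSpace ℝ (Fin d)) (lam β : ℝ) (D : OfflineDataset S A H K)
    (π : MDPPolicy S A H) : Prop :=
  ∀ (h : Fin H) (x : S) (ν : Measure A), IsProbabilityMeasure ν →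
    ∫ a, qHat φ lam β D π h (x, a) ∂ν ≤ ∫ a, qHat φ lam β D π h (x, a) ∂(π.act h x)

end PEVI

/-- The event that at all steps, states and actions the estimated Bellman update `Bhat` is within
`Γ` of the true Bellman update `B`. -/
def accuracyEvent {Ω S A : Type*} {H : ℕ} (Bhat B Γ : Ω → Fin H → S × A → ℝ) : Set Ω :=
  {ω | ∀ h z, |Bhat ω h z - B ω h z| ≤ Γ ω h z}

/-- `Γ` is a `ξ`-uncertainty quantifier: the accuracy event has probability at least `1 - ξ`.
To be meaningful also when measurability of the event is not known, this is stated for its inner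
probability. -/
def IsUncertaintyQuantifier {Ω S A : Type*} [MeasurableSpace Ω] {H : ℕ} (P : Measure Ω) (ξ : ℝ)
    (Bhat B Γ : Ω → Fin H → S × A → ℝ) : Prop :=
  ∃ E ⊆ accuracyEvent Bhat B Γ, MeasurableSet E ∧ ENNReal.ofReal (1 - ξ) ≤ P E

end

/-! The suboptimality bound is deterministic on the accuracy event. There the model error `B V̂ -
Q̂` lies in `[0, 2Γ]` (`bellman_sub_qHat_mem`): subtracting `Γ` makes `Q̂` an underestimate, and
truncation at the number of remaining steps costs nothing since the true update obeys the same
bound. A value-difference identity (`value_eq_add_sum_expectSA`) expands the values of `π*` and of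
the output around the same `V̂`. The errors along the output are nonnegative and can be dropped,
greediness gives the policy mismatch a favourable sign, and what is left is `2Γ` averaged along
`π*`.

For the accuracy event, linearity gives `B V̂ = ⟨φ, w⟩` with `‖w‖ ≤ H√d`, so the ridge error at `z`
is at most `(√N + ‖w‖)` times the width, where `N = sᵀ Λ⁻¹ s` and `s` is the feature-weighted sum of
the regression noise. The aim is `√N = O(dH √(log Q))` with `Q = 2dHK/ξ`. Since `V̂` is built from
the same data, the noise is not a martingale, and one first freezes a value function `V` and a
direction `v`. Hoeffding's lemma and compliance then give `E exp(∑ ((v·φ) η - H²/8 (v·φ)²)) ≤ 1`,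
while at `V = V̂` and `v = Λ⁻¹ s / H²` the exponent is at least `7N/(8H²)`
(`noiseEnergy_le_sum_logIncrement`).

The pair `(V̂, v)` at a given step is controlled by `d + d² + d` bounded numbers: the ridge weights
and the entries of `Λ⁻¹` behind `V̂`, and the coordinates of `v`. Rounding them sorts the outcomes
into finitely many classes, whose number has logarithm `O(d² log Q)`. Each nonempty class is
represented by the pair computed from one frozen outcome `ω'`. That pair is deterministic, so
Markov's inequality and a union bound apply without any measurability of `V̂` in `ω`; within a class
the exponent moves by at most `1`. Discretizing the direction as well takes the place of a
self-normalized martingale inequality. -/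

section LinearMDP

/-! ### Integration against the vector measure of a linear MDP -/

theorem measure_le_variation_of_real_eq_inner {S E : Type*} [MeasurableSpace S]
    [NormedAddCommGroup E] [InnerProductSpace ℝ E] {μ : VectorMeasure S E}
    {e : E} (he : ‖e‖ ≤ 1) {ν : Measure S} [IsFiniteMeasure ν]
    (hν : ∀ B, MeasurableSet B → ν.real B = inner ℝ e (μ B)) : ν ≤ μ.variation := by
  refine Measure.le_iff.2 fun B hB => ?_
  refine le_trans ?_ (μ.enorm_measure_le_variation B)
  rw [← ofReal_measureReal, hν B hB, ← ofReal_norm]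
  refine ENNReal.ofReal_le_ofReal ((real_inner_le_norm _ _).trans ?_)
  exact mul_le_of_le_one_left (norm_nonneg _) he

/-- Both sides are linear in `f` and agree on indicators. Because `‖e‖ ≤ 1` forces `ν ≤
μ.variation`, both are also continuous in `L¹(μ.variation)`, and density of simple functions
concludes. -/
theorem integral_eq_inner_vectorIntegral {S E : Type*} [MeasurableSpace S]
    [NormedAddCommGroup E] [InnerProductSpace ℝ E] [CompleteSpace E] {μ : VectorMeasure S E}
    [IsFiniteMeasure μ.variation] {e : E} (he : ‖e‖ ≤ 1) {ν : Measure S} [IsFiniteMeasure ν]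
    (hν : ∀ B, MeasurableSet B → ν.real B = inner ℝ e (μ B))
    {f : S → ℝ} (hf : Integrable f μ.variation) :
    ∫ x, f x ∂ν = inner ℝ e (μ.integral f (ContinuousLinearMap.lsmul ℝ ℝ)) := by
  have hle := measure_le_variation_of_real_eq_inner he hν
  refine Integrable.induction (μ := μ.variation)
    (fun f => ∫ x, f x ∂ν = inner ℝ e (μ.integral f (ContinuousLinearMap.lsmul ℝ ℝ)))
    ?_ ?_ ?_ ?_ hf
  · intro c s hs hs'
    rw [integral_indicator_const _ hs, VectorMeasure.integral,
      setToFun_indicator_const _ hs hs'.ne, hν s hs, transpose_eq_cbmApplyMeasure,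
      cbmApplyMeasure_apply]
    simp [inner_smul_right, mul_comm]
  · intro f g _ hf hg hf' hg'
    rw [VectorMeasure.integral_add hf hg, inner_add_right, ← hf', ← hg',
      ← integral_add (hf.mono_measure hle) (hg.mono_measure hle)]
    rfl
  · refine isClosed_eq ?_ (continuous_const.inner VectorMeasure.continuous_integral)
    refine (LipschitzWith.of_dist_le_mul (K := 1) fun f g => ?_).continuous
    have hf := L1.integrable_coeFn f
    have hg := L1.integrable_coeFn g
    rw [Real.dist_eq, ← integral_sub (hf.mono_measure hle) (hg.mono_measure hle),
      L1.dist_eq_integral_dist, NNReal.coe_one, one_mul]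
    refine (abs_integral_le_integral_abs).trans ?_
    simp only [Real.dist_eq]
    exact integral_mono_measure hle (ae_of_all _ fun _ => abs_nonneg _) (hf.sub hg).abs
  · intro f g hfg _ h
    rw [← VectorMeasure.integral_congr_ae hfg, ← h]
    exact (integral_congr_ae (hle.absolutelyContinuous.ae_le hfg)).symm

variable {S A : Type*} [MeasurableSpace S] [MeasurableSpace A] {H d : ℕ}

namespace EpisodicMDP

theorem integrable_reward (M : EpisodicMDP S A H) (h : Fin H) (z : S × A) :
    Integrable (fun y : ℝ × S => y.1) (M.step h z) :=
  Integrable.of_mem_Icc 0 1 measurable_fst.aemeasurable (M.reward_mem h z)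

theorem integrable_next (M : EpisodicMDP S A H) (h : Fin H) (z : S × A) {V : S → ℝ} {C : ℝ}
    (hV : Measurable V) (hV' : ∀ x, V x ∈ Set.Icc 0 C) :
    Integrable (fun y : ℝ × S => V y.2) (M.step h z) :=
  Integrable.of_mem_Icc 0 C (hV.comp measurable_snd).aemeasurable (ae_of_all _ fun y => hV' y.2)

theorem integrable_reward_add (M : EpisodicMDP S A H) (h : Fin H) (z : S × A) {V : S → ℝ} {C : ℝ}
    (hV : Measurable V) (hV' : ∀ x, V x ∈ Set.Icc 0 C) :
    Integrable (fun y : ℝ × S => y.1 + V y.2) (M.step h z) :=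
  (M.integrable_reward h z).add (M.integrable_next h z hV hV')

theorem bellman_eq_add (M : EpisodicMDP S A H) (h : Fin H) (z : S × A) {V : S → ℝ} {C : ℝ}
    (hV : Measurable V) (hV' : ∀ x, V x ∈ Set.Icc 0 C) :
    M.bellman h V z = M.meanReward h z + ∫ x, V x ∂(M.transition h z) := by
  rw [bellman, integral_add (M.integrable_reward h z) (M.integrable_next h z hV hV'), meanReward,
    transition, Kernel.snd_apply, integral_map measurable_snd.aemeasurable
      hV.aestronglyMeasurable]

theorem reward_add_mem (M : EpisodicMDP S A H) (h : Fin H) (z : S × A) {V : S → ℝ} {C : ℝ}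
    (hV' : ∀ x, V x ∈ Set.Icc 0 C) :
    ∀ᵐ y ∂(M.step h z), y.1 + V y.2 ∈ Set.Icc 0 (1 + C) := by
  filter_upwards [M.reward_mem h z] with y hy
  exact ⟨add_nonneg hy.1 (hV' _).1, add_le_add hy.2 (hV' _).2⟩

theorem bellman_mem (M : EpisodicMDP S A H) (h : Fin H) (z : S × A) {V : S → ℝ} {C : ℝ}
    (hV : Measurable V) (hV' : ∀ x, V x ∈ Set.Icc 0 C) :
    M.bellman h V z ∈ Set.Icc 0 (1 + C) := by
  have hint := M.integrable_reward_add h z hV hV'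
  have hmem := M.reward_add_mem h z hV'
  constructor
  · exact integral_nonneg_of_ae (hmem.mono fun y hy => hy.1)
  · refine (integral_mono_ae hint (integrable_const (1 + C)) (hmem.mono fun y hy => hy.2)).trans ?_
    simp

theorem measurable_bellman (M : EpisodicMDP S A H) (h : Fin H) {V : S → ℝ} (hV : Measurable V) :
    Measurable (M.bellman h V) := by
  have : StronglyMeasurable (fun p : (S × A) × ℝ × S => p.2.1 + V p.2.2) := by
    refine Measurable.stronglyMeasurable ?_
    fun_prop
  exact (this.integral_kernel_prod_right' (κ := M.step h)).measurable

/-- In a linear MDP, the Bellman update of a bounded value function is linear in the features. -/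
theorem IsLinear.exists_bellman_eq_inner {M : EpisodicMDP S A H}
    {φ : S × A → EuclideanSpace ℝ (Fin d)} (hM : M.IsLinear φ) (h : Fin H) {V : S → ℝ} {C : ℝ}
    (hC : 0 ≤ C) (hV : Measurable V) (hV' : ∀ x, V x ∈ Set.Icc 0 C) :
    ∃ w : EuclideanSpace ℝ (Fin d), ‖w‖ ≤ (1 + C) * Real.sqrt d ∧
      ∀ z, M.bellman h V z = inner ℝ (φ z) w := by
  obtain ⟨hφ, μ, θ, hμθ⟩ := hM
  obtain ⟨hμ, hθ, hP, hr⟩ := hμθ h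
  have hfin : IsFiniteMeasure (μ h).variation := ⟨hμ.trans_lt ENNReal.ofReal_lt_top⟩
  have hint : Integrable V (μ h).variation :=
    Integrable.of_mem_Icc 0 C hV.aemeasurable (ae_of_all _ hV')
  -- The reward vector contributes `√d` to the norm, the integral of `V` at most `C√d`.
  refine ⟨θ h + (μ h).integral V (ContinuousLinearMap.lsmul ℝ ℝ), ?_, fun z => ?_⟩
  · have h1 := VectorMeasure.norm_integral_le_of_norm_le_const (μ := μ h)
      (B := ContinuousLinearMap.lsmul ℝ ℝ (E := EuclideanSpace ℝ (Fin d))) (f := V) (C := C)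
      (ae_of_all _ fun x => by
        rw [Real.norm_eq_abs, abs_of_nonneg (hV' x).1]; exact (hV' x).2)
    have h2 : (μ h).variation.real Set.univ ≤ Real.sqrt d :=
      ENNReal.toReal_le_of_le_ofReal (Real.sqrt_nonneg _) hμ
    have h3 : ‖ContinuousLinearMap.lsmul ℝ ℝ (E := EuclideanSpace ℝ (Fin d))‖ ≤ 1 :=
      ContinuousLinearMap.opNorm_lsmul_le
    refine (norm_add_le _ _).trans ?_
    have h4 : C * ‖ContinuousLinearMap.lsmul ℝ ℝ (E := EuclideanSpace ℝ (Fin d))‖ *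
        (μ h).variation.real Set.univ ≤ C * 1 * Real.sqrt d := by gcongr
    linarith
  · have : IsMarkovKernel (M.transition h) := by unfold transition; infer_instance
    rw [bellman_eq_add M h z hV hV', inner_add_right, hr z,
      integral_eq_inner_vectorIntegral (hφ z) (hP z) hint]

end EpisodicMDP

end LinearMDP

/-! ### Trajectory laws and the value-difference identity -/

section Trajectories

variable {S A : Type*} [MeasurableSpace S] [MeasurableSpace A] {H : ℕ}

namespace EpisodicMDP

theorem measurable_snoc_step (n : ℕ) :
    Measurable (fun p : ((Fin n → S × A × ℝ) × S) × A × ℝ × S =>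
      ((Fin.snoc (α := fun _ => S × A × ℝ) p.1.1 (p.1.2, p.2.1, p.2.2.1), p.2.2.2) :
        (Fin (n + 1) → S × A × ℝ) × S)) := by
  refine Measurable.prodMk (measurable_pi_lambda _ fun i => ?_) (by fun_prop)
  refine Fin.lastCases ?_ (fun i => ?_) i
  · simp only [Fin.snoc_last]; fun_prop
  · simp only [Fin.snoc_castSucc]; fun_prop

instance isProbabilityMeasure_trajPrefix (M : EpisodicMDP S A H) (π : MDPPolicy S A H) (x : S) :
    ∀ (n : ℕ) (hn : n ≤ H), IsProbabilityMeasure (M.trajPrefix π x n hn)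
  | 0, _ => by unfold trajPrefix; infer_instance
  | n + 1, hn => by
    have := isProbabilityMeasure_trajPrefix M π x n (Nat.le_of_succ_le hn)
    unfold trajPrefix
    exact Measure.isProbabilityMeasure_map (measurable_snoc_step n).aemeasurable

instance isProbabilityMeasure_trajLaw (M : EpisodicMDP S A H) (π : MDPPolicy S A H) (x : S) :
    IsProbabilityMeasure (M.trajLaw π x) :=
  M.isProbabilityMeasure_trajPrefix π x H le_rfl

theorem ae_trajPrefix_reward_mem (M : EpisodicMDP S A H) (π : MDPPolicy S A H) (x : S) :
    ∀ (n : ℕ) (hn : n ≤ H), ∀ᵐ t ∂(M.trajPrefix π x n hn), ∀ i, (t.1 i).2.2 ∈ Set.Icc (0 : ℝ) 1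
  | 0, _ => ae_of_all _ fun _ i => i.elim0
  | n + 1, hn => by
    have ih := ae_trajPrefix_reward_mem M π x n (Nat.le_of_succ_le hn)
    have hmeas : ∀ m, MeasurableSet
        {t : (Fin m → S × A × ℝ) × S | ∀ i, (t.1 i).2.2 ∈ Set.Icc (0 : ℝ) 1} := fun m => by
      rw [Set.ofPred_forall]
      exact MeasurableSet.iInter fun i => measurableSet_Icc.preimage (by fun_prop)
    unfold trajPrefix
    rw [ae_map_iff (measurable_snoc_step n).aemeasurable (hmeas _)]
    refine Measure.ae_compProd_of_ae_ae (measurable_snoc_step n (hmeas _)) ?_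
    filter_upwards [ih] with p hp
    rw [Kernel.comap_apply]
    have hset : MeasurableSet {y : A × ℝ × S | y.2.1 ∈ Set.Icc (0 : ℝ) 1} :=
      measurableSet_Icc.preimage (by fun_prop)
    have : ∀ᵐ y ∂((π.act ⟨n, hn⟩ ⊗ₖ M.step ⟨n, hn⟩) p.2), y.2.1 ∈ Set.Icc (0 : ℝ) 1 :=
      (Kernel.ae_compProd_iff hset).2 (ae_of_all _ fun a => M.reward_mem _ _)
    filter_upwards [this] with y hy i
    refine Fin.lastCases ?_ (fun i => ?_) i
    · simpa only [Fin.snoc_last] using hy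
    · simpa only [Fin.snoc_castSucc] using hp i

theorem integral_trajPrefix_succ (M : EpisodicMDP S A H) (π : MDPPolicy S A H) (x : S) (n : ℕ)
    (hn : n + 1 ≤ H) {F : (Fin (n + 1) → S × A × ℝ) × S → ℝ} (hF : Measurable F)
    (hF' : Integrable F (M.trajPrefix π x (n + 1) hn)) :
    ∫ t, F t ∂(M.trajPrefix π x (n + 1) hn) =
      ∫ p, ∫ y, F (Fin.snoc (α := fun _ => S × A × ℝ) p.1 (p.2, y.1, y.2.1), y.2.2)
        ∂((π.act ⟨n, hn⟩ ⊗ₖ M.step ⟨n, hn⟩) p.2) ∂(M.trajPrefix π x n (Nat.le_of_succ_le hn)) := by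
  have hsnoc := measurable_snoc_step (S := S) (A := A) n
  have hdef : M.trajPrefix π x (n + 1) hn =
      ((M.trajPrefix π x n (Nat.le_of_succ_le hn)) ⊗ₘ
        ((π.act ⟨n, hn⟩ ⊗ₖ M.step ⟨n, hn⟩).comap Prod.snd measurable_snd)).map
        (fun p => (Fin.snoc (α := fun _ => S × A × ℝ) p.1.1 (p.1.2, p.2.1, p.2.2.1), p.2.2.2)) :=
    rfl
  rw [hdef] at hF' ⊢
  rw [integrable_map_measure hF.aestronglyMeasurable hsnoc.aemeasurable] at hF'
  rw [integral_map hsnoc.aemeasurable hF.aestronglyMeasurable]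
  exact Measure.integral_compProd hF'

/-- Cumulative reward of the first `n` steps, compensated by `g`, plus the final value. -/
def compensatedReturn (g : Fin H → S × A → ℝ) (V : Fin (H + 1) → S → ℝ) (n : ℕ) (hn : n ≤ H)
    (t : (Fin n → S × A × ℝ) × S) : ℝ :=
  ∑ i : Fin n, ((t.1 i).2.2 - g (Fin.castLE hn i) ((t.1 i).1, (t.1 i).2.1)) +
    V ⟨n, Nat.lt_succ_of_le hn⟩ t.2

theorem measurable_compensatedReturn {g : Fin H → S × A → ℝ} {V : Fin (H + 1) → S → ℝ}
    (hg : ∀ i, Measurable (g i)) (hV : ∀ k, Measurable (V k)) (n : ℕ) (hn : n ≤ H) :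
    Measurable (compensatedReturn g V n hn) := by
  unfold compensatedReturn
  fun_prop

theorem integrable_compensatedReturn (M : EpisodicMDP S A H) (π : MDPPolicy S A H) (x : S)
    {g : Fin H → S × A → ℝ} {V : Fin (H + 1) → S → ℝ} {C : ℝ}
    (hg : ∀ i, Measurable (g i)) (hg' : ∀ i z, |g i z| ≤ C)
    (hV : ∀ k, Measurable (V k)) (hV' : ∀ k x, |V k x| ≤ C) (n : ℕ) (hn : n ≤ H) :
    Integrable (compensatedReturn g V n hn) (M.trajPrefix π x n hn) := by
  refine Integrable.of_bound (measurable_compensatedReturn hg hV n hn).aestronglyMeasurable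
    (n * (1 + C) + C) ?_
  filter_upwards [M.ae_trajPrefix_reward_mem π x n hn] with t ht
  refine (norm_add_le _ _).trans (add_le_add ((norm_sum_le _ _).trans ?_) (hV' _ _))
  refine (Finset.sum_le_card_nsmul _ _ (1 + C) fun i _ => (norm_sub_le _ _).trans ?_).trans ?_
  · refine add_le_add ?_ (hg' _ _)
    rw [Real.norm_eq_abs, abs_of_nonneg (ht i).1]
    exact (ht i).2
  · simp [mul_add]

/-- A martingale argument: by `hgV`, averaging over the action, reward and next state replaces the
last compensated reward plus `V` at the new state by `V` at the previous state, so the expectation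
does not depend on `n`. -/
theorem integral_compensatedReturn (M : EpisodicMDP S A H) (π : MDPPolicy S A H) (x : S)
    {V : Fin (H + 1) → S → ℝ} {g : Fin H → S × A → ℝ} {C : ℝ}
    (hV : ∀ k, Measurable (V k)) (hV' : ∀ k x, V k x ∈ Set.Icc 0 C)
    (hg : ∀ i, Measurable (g i)) (hg' : ∀ i z, |g i z| ≤ C)
    (hgV : ∀ i s, ∫ a, (M.bellman i (V i.succ) (s, a) - g i (s, a)) ∂(π.act i s) =
      V i.castSucc s) :
    ∀ (n : ℕ) (hn : n ≤ H),
      ∫ t, compensatedReturn g V n hn t ∂(M.trajPrefix π x n hn) = V 0 x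
  | 0, hn => by
    unfold trajPrefix
    rw [integral_dirac' _ _ (measurable_compensatedReturn hg hV 0 hn).stronglyMeasurable]
    simp [compensatedReturn]
  | n + 1, hn => by
    have hV'' : ∀ k x, |V k x| ≤ C := fun k x => by
      rw [abs_of_nonneg (hV' k x).1]; exact (hV' k x).2
    rw [M.integral_trajPrefix_succ π x n hn (measurable_compensatedReturn hg hV _ _)
      (M.integrable_compensatedReturn π x hg hg' hV hV'' _ _),
      ← integral_compensatedReturn M π x hV hV' hg hg' hgV n (Nat.le_of_succ_le hn)]
    refine integral_congr_ae (ae_of_all _ fun p => ?_)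
    set i : Fin H := ⟨n, hn⟩ with hi
    set c : ℝ := ∑ j : Fin n, ((p.1 j).2.2 -
      g (Fin.castLE (Nat.le_of_succ_le hn) j) ((p.1 j).1, (p.1 j).2.1)) with hc
    have hF : ∀ y : A × ℝ × S, compensatedReturn g V (n + 1) hn
        (Fin.snoc (α := fun _ => S × A × ℝ) p.1 (p.2, y.1, y.2.1), y.2.2) =
        (y.2.1 + V i.succ y.2.2) + (c - g i (p.2, y.1)) := fun y => by
      unfold compensatedReturn
      rw [Fin.sum_univ_castSucc]
      simp only [Fin.snoc_castSucc, Fin.snoc_last]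
      have h1 : ∀ j : Fin n, Fin.castLE hn j.castSucc = Fin.castLE (Nat.le_of_succ_le hn) j :=
        fun j => rfl
      have h2 : Fin.castLE hn (Fin.last n) = i := rfl
      have h3 : (⟨n + 1, Nat.lt_succ_of_le hn⟩ : Fin (H + 1)) = i.succ := rfl
      simp only [h1, h2, h3, hc]
      ring
    simp only [hF]
    have hint : Integrable (fun y : A × ℝ × S => y.2.1 + V i.succ y.2.2)
        ((π.act i ⊗ₖ M.step i) p.2) := by
      refine Integrable.of_mem_Icc 0 (1 + C) (by fun_prop) ?_
      refine (Kernel.ae_compProd_iff (measurableSet_Icc.preimage (by fun_prop))).2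
        (ae_of_all _ fun a => M.reward_add_mem i _ (hV' _))
    have hint' : Integrable (fun y : A × ℝ × S => c - g i (p.2, y.1))
        ((π.act i ⊗ₖ M.step i) p.2) := by
      refine (integrable_const c).sub (Integrable.of_bound (C := C) ?_
        (ae_of_all _ fun y => hg' _ _))
      exact ((hg i).comp (by fun_prop)).aestronglyMeasurable
    refine (integral_compProd (hint.add hint')).trans ?_
    simp only [Pi.add_apply]
    have hinner : ∀ a, ∫ y, ((y.1 + V i.succ y.2) + (c - g i (p.2, a))) ∂(M.step i (p.2, a)) =
        (M.bellman i (V i.succ) (p.2, a) - g i (p.2, a)) + c := fun a => by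
      rw [integral_add (M.integrable_reward_add i _ (hV _) (hV' _)) (integrable_const _)]
      simp only [integral_const, probReal_univ, one_smul]
      change M.bellman i (V i.succ) (p.2, a) + _ = _
      ring
    simp only [hinner]
    rw [integral_add _ (integrable_const _), hgV]
    · simp only [integral_const, probReal_univ, one_smul]
      exact add_comm _ _
    · refine Integrable.of_bound (C := 1 + C + C) (((M.measurable_bellman i (hV _)).sub
        (hg i)).comp (by fun_prop)).aestronglyMeasurable (ae_of_all _ fun a => ?_)
      have hB := M.bellman_mem i (p.2, a) (hV i.succ) (hV' _)
      refine (norm_sub_le _ _).trans (add_le_add ?_ (hg' _ _))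
      rw [Real.norm_eq_abs, abs_of_nonneg hB.1]
      exact hB.2

/-- The compensated return at time `H` has mean `V 0 x`, and `V` vanishes there, so the compensators
`g` account exactly for the difference between the value and `V 0 x`. -/
theorem value_eq_add_sum_expectSA (M : EpisodicMDP S A H) (π : MDPPolicy S A H) (x : S)
    {V : Fin (H + 1) → S → ℝ} {g : Fin H → S × A → ℝ} {C : ℝ}
    (hV : ∀ k, Measurable (V k)) (hV' : ∀ k x, V k x ∈ Set.Icc 0 C)
    (hlast : V (Fin.last H) = 0)
    (hg : ∀ i, Measurable (g i)) (hg' : ∀ i z, |g i z| ≤ C)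
    (hgV : ∀ i s, ∫ a, (M.bellman i (V i.succ) (s, a) - g i (s, a)) ∂(π.act i s) =
      V i.castSucc s) :
    M.value π x = V 0 x + ∑ h, M.expectSA π x h (g h) := by
  have key := M.integral_compensatedReturn π x hV hV' hg hg' hgV H le_rfl
  have hintg : ∀ i, Integrable (fun t : (Fin H → S × A × ℝ) × S =>
      g i ((t.1 i).1, (t.1 i).2.1)) (M.trajLaw π x) := fun i =>
    Integrable.of_bound (((hg i).comp (by fun_prop)).aestronglyMeasurable) C
      (ae_of_all _ fun _ => hg' _ _)
  have hintr : ∀ i, Integrable (fun t : (Fin H → S × A × ℝ) × S => (t.1 i).2.2)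
      (M.trajLaw π x) := fun i =>
    Integrable.of_mem_Icc 0 1 (by fun_prop)
      ((M.ae_trajPrefix_reward_mem π x H le_rfl).mono fun t ht => ht i)
  have hfun : ∀ t, compensatedReturn g V H le_rfl t =
      ∑ i, (t.1 i).2.2 - ∑ i, g i ((t.1 i).1, (t.1 i).2.1) := fun t => by
    have : V ⟨H, Nat.lt_succ_of_le le_rfl⟩ = 0 := hlast
    simp [compensatedReturn, this]
  simp only [hfun] at key
  change ∫ t, _ ∂(M.trajLaw π x) = _ at key
  rw [integral_sub (integrable_finsetSum _ fun i _ => hintr i)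
    (integrable_finsetSum _ fun i _ => hintg i), integral_finsetSum _ fun i _ => hintg i] at key
  unfold value expectSA
  linarith

end EpisodicMDP

end Trajectories

/-! ### Cauchy–Schwarz estimates for dot products -/

section DotProduct

variable {n : Type*} [Fintype n]

theorem Matrix.PosSemidef.sq_dotProduct_mulVec_le {M : Matrix n n ℝ} (hM : M.PosSemidef)
    (x y : n → ℝ) :
    (x ⬝ᵥ M.mulVec y) ^ 2 ≤ (x ⬝ᵥ M.mulVec x) * (y ⬝ᵥ M.mulVec y) := by
  classical
  have h := LinearMap.BilinForm.apply_mul_apply_le_of_forall_zero_le (Matrix.toLinearMap₂' ℝ M)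
    (fun x => by
      rw [Matrix.toLinearMap₂'_apply']
      simpa using hM.dotProduct_mulVec_nonneg x) x y
  simp only [Matrix.toLinearMap₂'_apply'] at h
  have hsymm : y ⬝ᵥ M.mulVec x = x ⬝ᵥ M.mulVec y := by
    have hT : M.transpose = M := by simpa using hM.isHermitian.eq
    rw [Matrix.dotProduct_mulVec, ← Matrix.mulVec_transpose, hT, dotProduct_comm]
  rw [hsymm] at h
  rwa [sq]

theorem sq_dotProduct_le (x y : n → ℝ) : (x ⬝ᵥ y) ^ 2 ≤ (x ⬝ᵥ x) * (y ⬝ᵥ y) := by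
  classical
  simpa using (Matrix.PosSemidef.one (n := n) (R := ℝ)).sq_dotProduct_mulVec_le x y

theorem dotProduct_self_nonneg_real (x : n → ℝ) : 0 ≤ x ⬝ᵥ x :=
  Finset.sum_nonneg fun i _ => mul_self_nonneg (x i)

theorem abs_dotProduct_le_of_le {x y : n → ℝ} {a b : ℝ} (ha : 0 ≤ a) (hb : 0 ≤ b)
    (hx : x ⬝ᵥ x ≤ a ^ 2) (hy : y ⬝ᵥ y ≤ b ^ 2) : |x ⬝ᵥ y| ≤ a * b := by
  refine abs_le_of_sq_le_sq ?_ (mul_nonneg ha hb)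
  calc (x ⬝ᵥ y) ^ 2 ≤ (x ⬝ᵥ x) * (y ⬝ᵥ y) := sq_dotProduct_le x y
    _ ≤ a ^ 2 * b ^ 2 := mul_le_mul hx hy (dotProduct_self_nonneg_real y) (sq_nonneg a)
    _ = (a * b) ^ 2 := by ring

theorem abs_apply_le_of_dotProduct_self_le {x : n → ℝ} {a : ℝ} (ha : 0 ≤ a)
    (hx : x ⬝ᵥ x ≤ a ^ 2) (i : n) : |x i| ≤ a := by
  refine abs_le_of_sq_le_sq (le_trans ?_ hx) ha
  rw [sq]
  exact Finset.single_le_sum (f := fun i => x i * x i) (fun j _ => mul_self_nonneg (x j))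
    (Finset.mem_univ i)

theorem abs_dotProduct_le_card_mul {x y : n → ℝ} {a b : ℝ} (hx : ∀ i, |x i| ≤ a)
    (hy : ∀ i, |y i| ≤ b) : |x ⬝ᵥ y| ≤ Fintype.card n * (a * b) := by
  refine (Finset.abs_sum_le_sum_abs _ _).trans
    ((Finset.sum_le_card_nsmul _ _ (a * b) fun i _ => ?_).trans_eq ?_)
  · rw [abs_mul]
    exact mul_le_mul (hx i) (hy i) (abs_nonneg _) ((abs_nonneg _).trans (hx i))
  · rw [nsmul_eq_mul]; rfl

/-- The Euclidean norm of a finite combination of vectors of norm at most one. -/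
theorem sum_smul_dotProduct_self_le {ι : Type*} (s : Finset ι) {f : ι → n → ℝ} {c : ι → ℝ} {C : ℝ}
    (hC : 0 ≤ C) (hf : ∀ i, f i ⬝ᵥ f i ≤ 1) (hc : ∀ i, |c i| ≤ C) :
    (∑ i ∈ s, c i • f i) ⬝ᵥ (∑ i ∈ s, c i • f i) ≤ (s.card * C) ^ 2 := by
  have hij : ∀ i j, (c i • f i) ⬝ᵥ (c j • f j) ≤ C * C := fun i j => by
    have h := abs_dotProduct_le_of_le zero_le_one zero_le_one
      ((hf i).trans_eq (one_pow 2).symm) ((hf j).trans_eq (one_pow 2).symm)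
    rw [smul_dotProduct, dotProduct_smul, smul_eq_mul, smul_eq_mul]
    refine (le_abs_self _).trans ?_
    rw [abs_mul, abs_mul]
    refine mul_le_mul (hc i) ?_ (by positivity) hC
    exact (mul_le_mul (hc j) h (abs_nonneg _) hC).trans_eq (by ring)
  rw [sum_dotProduct]
  refine (Finset.sum_le_card_nsmul _ _ (s.card * (C * C)) fun i _ => ?_).trans_eq
    (by rw [nsmul_eq_mul]; ring)
  rw [dotProduct_sum]
  exact (Finset.sum_le_card_nsmul _ _ (C * C) fun j _ => hij i j).trans_eq (nsmul_eq_mul _ _)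

theorem EuclideanSpace.dotProduct_self_eq_norm_sq (x : EuclideanSpace ℝ n) :
    x.ofLp ⬝ᵥ x.ofLp = ‖x‖ ^ 2 := by
  rw [← real_inner_self_eq_norm_sq, EuclideanSpace.inner_eq_star_dotProduct]
  simp

theorem EuclideanSpace.real_inner_eq_dotProduct (x y : EuclideanSpace ℝ n) :
    inner ℝ x y = x.ofLp ⬝ᵥ y.ofLp := by
  rw [EuclideanSpace.inner_eq_star_dotProduct, dotProduct_comm]
  simp

theorem EuclideanSpace.dotProduct_self_le_one {x : EuclideanSpace ℝ n} (hx : ‖x‖ ≤ 1) :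
    x.ofLp ⬝ᵥ x.ofLp ≤ 1 := by
  rw [dotProduct_self_eq_norm_sq]
  exact pow_le_one₀ (norm_nonneg _) hx

end DotProduct

/-! ### The regularized Gram matrix and its inverse -/

namespace PEVI

section Gram

variable {S A : Type*} {H K d : ℕ} (φ : S × A → EuclideanSpace ℝ (Fin d))
  (D : OfflineDataset S A H K) (h : Fin H)

/-- The feature vector of the `τ`-th observation at step `h`. -/
def feature (τ : Fin K) : Fin d → ℝ :=
  (φ (D.state τ h.castSucc, D.action τ h)).ofLp

theorem dotProduct_gram_mulVec (x y : Fin d → ℝ) :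
    x ⬝ᵥ (gram φ 1 D h).mulVec y =
      ∑ τ, (x ⬝ᵥ feature φ D h τ) * (feature φ D h τ ⬝ᵥ y) + x ⬝ᵥ y := by
  rw [gram, one_smul, Matrix.add_mulVec, Matrix.one_mulVec, dotProduct_add, Matrix.sum_mulVec,
    dotProduct_sum]
  congr 1
  refine Finset.sum_congr rfl fun τ _ => ?_
  rw [Matrix.vecMulVec_mulVec]
  simp [feature, dotProduct_smul, mul_comm]

theorem posDef_gram : (gram φ 1 D h).PosDef := by
  rw [gram, one_smul]
  refine Matrix.PosDef.posSemidef_add (Matrix.posSemidef_sum _ fun τ _ => ?_) Matrix.PosDef.one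
  simpa using Matrix.posSemidef_vecMulVec_self_star
    (φ (D.state τ h.castSucc, D.action τ h)).ofLp

theorem gram_mulVec_inv_mulVec (x : Fin d → ℝ) :
    (gram φ 1 D h).mulVec ((gram φ 1 D h)⁻¹.mulVec x) = x := by
  rw [Matrix.mulVec_mulVec, Matrix.mul_nonsing_inv _
    ((Matrix.isUnit_iff_isUnit_det _).1 (posDef_gram φ D h).isUnit), Matrix.one_mulVec]

theorem inv_gram_mulVec_gram_mulVec (x : Fin d → ℝ) :
    (gram φ 1 D h)⁻¹.mulVec ((gram φ 1 D h).mulVec x) = x := by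
  rw [Matrix.mulVec_mulVec, Matrix.nonsing_inv_mul _
    ((Matrix.isUnit_iff_isUnit_det _).1 (posDef_gram φ D h).isUnit), Matrix.one_mulVec]

theorem dotProduct_inv_gram_nonneg (x : Fin d → ℝ) :
    0 ≤ x ⬝ᵥ (gram φ 1 D h)⁻¹.mulVec x := by
  simpa using (posDef_gram φ D h).inv.posSemidef.dotProduct_mulVec_nonneg x

/-- With `y = Λ⁻¹ x` this is `y·y ≤ y·Λy`, that is, `Λ ≥ I`. It is the source of the bounds on `Λ⁻¹`
below. -/
theorem inv_gram_mulVec_dotProduct_self_le_dotProduct (x : Fin d → ℝ) :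
    ((gram φ 1 D h)⁻¹.mulVec x) ⬝ᵥ ((gram φ 1 D h)⁻¹.mulVec x) ≤
      x ⬝ᵥ (gram φ 1 D h)⁻¹.mulVec x := by
  set y := (gram φ 1 D h)⁻¹.mulVec x with hy
  have h1 : y ⬝ᵥ (gram φ 1 D h).mulVec y = x ⬝ᵥ y := by
    rw [hy, gram_mulVec_inv_mulVec, dotProduct_comm]
  rw [← h1, dotProduct_gram_mulVec]
  refine le_add_of_nonneg_left (Finset.sum_nonneg fun τ _ => ?_)
  rw [dotProduct_comm]
  exact mul_self_nonneg _

theorem inv_gram_mulVec_dotProduct_self_le (x : Fin d → ℝ) :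
    ((gram φ 1 D h)⁻¹.mulVec x) ⬝ᵥ ((gram φ 1 D h)⁻¹.mulVec x) ≤ x ⬝ᵥ x := by
  have h1 := inv_gram_mulVec_dotProduct_self_le_dotProduct φ D h x
  have h2 := sq_dotProduct_le x ((gram φ 1 D h)⁻¹.mulVec x)
  have h3 := dotProduct_self_nonneg_real ((gram φ 1 D h)⁻¹.mulVec x)
  have h4 := dotProduct_self_nonneg_real x
  by_contra hcon
  push Not at hcon
  nlinarith

theorem dotProduct_inv_gram_le (x : Fin d → ℝ) :
    x ⬝ᵥ (gram φ 1 D h)⁻¹.mulVec x ≤ x ⬝ᵥ x := by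
  have h1 := inv_gram_mulVec_dotProduct_self_le φ D h x
  have h2 := sq_dotProduct_le x ((gram φ 1 D h)⁻¹.mulVec x)
  have h4 := dotProduct_self_nonneg_real x
  refine le_of_sq_le_sq (h2.trans ?_) h4
  rw [sq]
  exact mul_le_mul_of_nonneg_left h1 h4

theorem abs_inv_gram_apply_le (i j : Fin d) : |(gram φ 1 D h)⁻¹ i j| ≤ 1 := by
  have h1 := inv_gram_mulVec_dotProduct_self_le φ D h (Pi.single j 1)
  have h2 := abs_apply_le_of_dotProduct_self_le zero_le_one (h1.trans (by simp)) i
  simpa using h2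

theorem abs_dotProduct_inv_gram_le (x y : Fin d → ℝ) :
    |x ⬝ᵥ (gram φ 1 D h)⁻¹.mulVec y| ≤
      Real.sqrt (x ⬝ᵥ (gram φ 1 D h)⁻¹.mulVec x) * Real.sqrt (y ⬝ᵥ (gram φ 1 D h)⁻¹.mulVec y) := by
  rw [← Real.sqrt_mul (dotProduct_inv_gram_nonneg φ D h x)]
  exact Real.abs_le_sqrt ((posDef_gram φ D h).inv.posSemidef.sq_dotProduct_mulVec_le x y)

theorem width_nonneg (z : S × A) : 0 ≤ width φ 1 D h z := Real.sqrt_nonneg _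

theorem width_le_one {z : S × A} (hφ : ‖φ z‖ ≤ 1) : width φ 1 D h z ≤ 1 := by
  rw [width, Real.sqrt_le_one]
  exact (dotProduct_inv_gram_le φ D h _).trans (EuclideanSpace.dotProduct_self_le_one hφ)

end Gram

theorem qStep_mem {S A : Type*} {H K d : ℕ} {φ : S × A → EuclideanSpace ℝ (Fin d)}
    {D : OfflineDataset S A H K} {lam β : ℝ} (h : Fin H) (V : S → ℝ) (z : S × A) :
    qStep φ lam β D h V z ∈ Set.Icc 0 ((H : ℝ) - (h : ℕ)) := by
  refine ⟨le_max_right _ _, max_le (min_le_right _ _) ?_⟩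
  rw [sub_nonneg]
  exact_mod_cast h.2.le

/-! ### Measurability, range and pessimism of the estimated values -/

section Values

variable {S A : Type*} [MeasurableSpace S] [MeasurableSpace A] {H K d : ℕ}
  {φ : S × A → EuclideanSpace ℝ (Fin d)} {D : OfflineDataset S A H K} {lam β : ℝ}
  {π : MDPPolicy S A H}

theorem measurable_feature_apply (hφ : Measurable φ) (i : Fin d) :
    Measurable fun z => (φ z).ofLp i :=
  (measurable_pi_apply i).comp ((WithLp.measurable_ofLp 2 _).comp hφ)

theorem measurable_width (hφ : Measurable φ) (h : Fin H) : Measurable (width φ lam D h) := by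
  have := measurable_feature_apply hφ
  unfold width
  simp only [dotProduct, Matrix.mulVec]
  fun_prop

theorem measurable_qStep (hφ : Measurable φ) (h : Fin H) (V : S → ℝ) :
    Measurable (qStep φ lam β D h V) := by
  have h1 := measurable_feature_apply hφ
  have h2 := measurable_width (lam := lam) (D := D) hφ h
  unfold qStep bellmanHat penalty
  simp only [dotProduct]
  fun_prop

theorem vHat_last : vHat φ lam β D π (Fin.last H) = 0 := by
  simp only [vHat, Fin.reverseInduction_last]
  rfl

theorem vHat_castSucc (h : Fin H) (x : S) :
    vHat φ lam β D π h.castSucc x = ∫ a, qHat φ lam β D π h (x, a) ∂(π.act h x) := by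
  simp only [vHat, Fin.reverseInduction_castSucc, qHat]

theorem measurable_qHat (hφ : Measurable φ) (h : Fin H) : Measurable (qHat φ lam β D π h) :=
  measurable_qStep hφ h _

theorem integrable_qHat (hφ : Measurable φ) (h : Fin H) (x : S) (ν : Measure A)
    [IsFiniteMeasure ν] : Integrable (fun a => qHat φ lam β D π h (x, a)) ν :=
  Integrable.of_mem_Icc 0 _ ((measurable_qHat hφ h).comp (by fun_prop)).aemeasurable
    (ae_of_all _ fun a => qStep_mem h _ (x, a))

theorem measurable_vHat (hφ : Measurable φ) (k : Fin (H + 1)) :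
    Measurable (vHat φ lam β D π k) := by
  refine Fin.lastCases ?_ (fun h => ?_) k
  · rw [vHat_last]; exact measurable_const
  · have := (measurable_qHat (lam := lam) (β := β) (D := D) (π := π) hφ h).stronglyMeasurable
    have h2 := (this.integral_kernel_prod_right' (κ := π.act h)).measurable
    rwa [show vHat φ lam β D π h.castSucc = _ from funext fun x => vHat_castSucc h x]

theorem vHat_mem (hφ : Measurable φ) (k : Fin (H + 1)) (x : S) :
    vHat φ lam β D π k x ∈ Set.Icc 0 ((H : ℝ) - (k : ℕ)) := by
  revert x
  refine Fin.lastCases ?_ (fun h => ?_) k <;> intro x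
  · rw [vHat_last]; simp
  · rw [vHat_castSucc]
    refine ⟨integral_nonneg fun a => (qStep_mem h _ _).1, ?_⟩
    refine (integral_mono (integrable_qHat hφ h x _) (integrable_const _)
      fun a => (qStep_mem h _ _).2).trans ?_
    simp

theorem vHat_succ_mem (hφ : Measurable φ) (h : Fin H) (x : S) :
    vHat φ lam β D π h.succ x ∈ Set.Icc 0 ((H : ℝ) - 1) := by
  have h1 := vHat_mem (lam := lam) (β := β) (D := D) (π := π) hφ h.succ x
  refine ⟨h1.1, h1.2.trans ?_⟩
  rw [Fin.val_succ]
  push_cast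
  linarith [(Nat.cast_nonneg (h : ℕ) : (0 : ℝ) ≤ (h : ℕ))]

/-- The true Bellman update exceeds the pessimistic Q-function by at most twice the penalty. -/
theorem bellman_sub_qHat_mem (hφ : Measurable φ) (M : EpisodicMDP S A H) (h : Fin H) (z : S × A)
    (hβ : 0 ≤ β)
    (hacc : |bellmanHat φ 1 D h (vHat φ 1 β D π h.succ) z -
      M.bellman h (vHat φ 1 β D π h.succ) z| ≤ penalty φ 1 β D h z) :
    M.bellman h (vHat φ 1 β D π h.succ) z - qHat φ 1 β D π h z ∈
      Set.Icc 0 (2 * penalty φ 1 β D h z) := by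
  have hB := M.bellman_mem h z (measurable_vHat (lam := 1) (β := β) (D := D) (π := π) hφ h.succ)
    (vHat_mem hφ h.succ)
  have hΓ : 0 ≤ penalty φ 1 β D h z := mul_nonneg hβ (width_nonneg φ D h z)
  obtain ⟨h1, h2⟩ := abs_le.1 hacc
  obtain ⟨h3, h4⟩ := hB
  rw [Fin.val_succ] at h4
  push_cast at h4
  rw [qHat, qStep]
  -- The lower bound uses `B ≥ B̂ - Γ` and `B ≥ 0`, so that neither argument of the outer maximum
  -- exceeds `B`. The upper bound uses `B - 2Γ ≤ B̂ - Γ` and `B ≤ 1 + (H - (h + 1))`, which is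
  -- exactly the truncation level.
  constructor
  · rw [sub_nonneg]
    exact max_le ((min_le_left _ _).trans (by linarith)) h3
  · have : M.bellman h (vHat φ 1 β D π h.succ) z - 2 * penalty φ 1 β D h z ≤
        min (bellmanHat φ 1 D h (vHat φ 1 β D π h.succ) z - penalty φ 1 β D h z)
          ((H : ℝ) - (h : ℕ)) := le_min (by linarith) (by linarith)
    linarith [this.trans (le_max_left _ 0)]

end Values

end PEVI

/-! ### Suboptimality on the accuracy event -/

namespace PEVI

section SubOptimality

variable {S A : Type*} [MeasurableSpace S] [MeasurableSpace A] {H K d : ℕ}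
  {φ : S × A → EuclideanSpace ℝ (Fin d)} {D : OfflineDataset S A H K} {β : ℝ}
  {πhat : MDPPolicy S A H}

/-- The model error of the algorithm plus the loss, at the current state, from playing `π` instead
of `πhat` in its Q-function. -/
noncomputable def policyGap (φ : S × A → EuclideanSpace ℝ (Fin d)) (β : ℝ) (D : OfflineDataset S A H K)
    (M : EpisodicMDP S A H) (πhat π : MDPPolicy S A H) (h : Fin H) (z : S × A) : ℝ :=
  (M.bellman h (vHat φ 1 β D πhat h.succ) z - qHat φ 1 β D πhat h z) +
    (∫ a, qHat φ 1 β D πhat h (z.1, a) ∂(π.act h z.1) - vHat φ 1 β D πhat h.castSucc z.1)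

theorem measurable_policyGap (hφ : Measurable φ) (M : EpisodicMDP S A H) (π : MDPPolicy S A H)
    (h : Fin H) : Measurable (policyGap φ β D M πhat π h) := by
  have h1 := measurable_qHat (lam := 1) (β := β) (D := D) (π := πhat) hφ h
  have h2 := (h1.stronglyMeasurable.integral_kernel_prod_right' (κ := π.act h)).measurable
  exact ((M.measurable_bellman h (measurable_vHat hφ _)).sub h1).add
    ((h2.comp measurable_fst).sub ((measurable_vHat hφ _).comp measurable_fst))

theorem abs_policyGap_le (hφ : Measurable φ) (M : EpisodicMDP S A H) (π : MDPPolicy S A H)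
    (h : Fin H) (z : S × A) : |policyGap φ β D M πhat π h z| ≤ 2 * (1 + (H : ℝ)) := by
  have hh : (0 : ℝ) ≤ (h : ℕ) := Nat.cast_nonneg _
  obtain ⟨h1, h2⟩ := M.bellman_mem h z
    (measurable_vHat (lam := 1) (β := β) (D := D) (π := πhat) hφ h.succ) (vHat_succ_mem hφ h)
  obtain ⟨h3, h4⟩ : qHat φ 1 β D πhat h z ∈ _ := qStep_mem h _ z
  obtain ⟨h5, h6⟩ := vHat_mem (lam := 1) (β := β) (D := D) (π := πhat) hφ h.castSucc z.1
  have h7 : 0 ≤ ∫ a, qHat φ 1 β D πhat h (z.1, a) ∂(π.act h z.1) :=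
    integral_nonneg fun a => (qStep_mem h _ _).1
  have h8 : ∫ a, qHat φ 1 β D πhat h (z.1, a) ∂(π.act h z.1) ≤ (H : ℝ) - (h : ℕ) := by
    refine (integral_mono (integrable_qHat hφ h z.1 _) (integrable_const _)
      fun a => (qStep_mem h _ _).2).trans ?_
    simp
  rw [Fin.val_castSucc] at h6
  rw [policyGap, abs_le]
  constructor <;> linarith

/-- Subtracting the gap from the Bellman update leaves `Q̂(s, a) - ∫ Q̂ dπ + V̂(s)`, whose average
over `π` is `V̂(s)`; this is the hypothesis `hgV` of the value-difference identity. -/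
theorem value_eq_vHat_add (hφ : Measurable φ) (M : EpisodicMDP S A H) (π : MDPPolicy S A H)
    (x : S) : M.value π x = vHat φ 1 β D πhat 0 x +
      ∑ h, M.expectSA π x h (policyGap φ β D M πhat π h) := by
  refine M.value_eq_add_sum_expectSA π x (C := 2 * (1 + (H : ℝ))) (measurable_vHat hφ)
    (fun k x => ?_) vHat_last (measurable_policyGap hφ M π) (abs_policyGap_le hφ M π)
    fun h s => ?_
  · obtain ⟨h1, h2⟩ := vHat_mem (lam := 1) (β := β) (D := D) (π := πhat) hφ k x
    have hk : (0 : ℝ) ≤ (k : ℕ) := Nat.cast_nonneg _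
    have hH : (0 : ℝ) ≤ H := Nat.cast_nonneg _
    exact ⟨h1, by linarith⟩
  · simp only [policyGap, sub_add_eq_sub_sub, sub_sub_cancel]
    rw [integral_sub (integrable_qHat hφ h s _) (integrable_const _)]
    simp

/-- Suboptimality of pessimistic value iteration on the accuracy event. -/
theorem value_sub_value_le (hφ : Measurable φ) (hφ' : ∀ z, ‖φ z‖ ≤ 1) (M : EpisodicMDP S A H)
    (hβ : 0 ≤ β) (hout : IsOutput φ 1 β D πhat)
    (hacc : ∀ h z, |bellmanHat φ 1 D h (vHat φ 1 β D πhat h.succ) z -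
      M.bellman h (vHat φ 1 β D πhat h.succ) z| ≤ penalty φ 1 β D h z)
    (π : MDPPolicy S A H) (x : S) :
    M.value π x - M.value πhat x ≤ 2 * β * ∑ h, M.expectSA π x h (width φ 1 D h) := by
  rw [value_eq_vHat_add (D := D) (β := β) (πhat := πhat) hφ M π x,
    value_eq_vHat_add (D := D) (β := β) (πhat := πhat) hφ M πhat x]
  -- For the output itself the mismatch term vanishes, and pessimism makes the remaining model error
  -- nonnegative.
  have hhat : ∀ h z, 0 ≤ policyGap φ β D M πhat πhat h z := fun h z => by
    rw [policyGap, vHat_castSucc, sub_self, add_zero]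
    exact (bellman_sub_qHat_mem hφ M h z hβ (hacc h z)).1
  -- Greediness makes the mismatch term nonpositive, so only the upper bound on the model error
  -- counts.
  have hpi : ∀ h z, policyGap φ β D M πhat π h z ≤ 2 * β * width φ 1 D h z := fun h z => by
    have h1 := (bellman_sub_qHat_mem hφ M h z hβ (hacc h z)).2
    have h2 := hout h z.1 (π.act h z.1) inferInstance
    rw [policyGap, vHat_castSucc]
    rw [penalty, ← mul_assoc] at h1
    linarith
  have hsum : 0 ≤ ∑ h, M.expectSA πhat x h (policyGap φ β D M πhat πhat h) :=
    Finset.sum_nonneg fun h _ => integral_nonneg fun t => hhat h _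
  have hsum' : ∑ h, M.expectSA π x h (policyGap φ β D M πhat π h) ≤
      2 * β * ∑ h, M.expectSA π x h (width φ 1 D h) := by
    rw [Finset.mul_sum]
    refine Finset.sum_le_sum fun h _ => ?_
    unfold EpisodicMDP.expectSA
    rw [← integral_const_mul]
    refine integral_mono ?_ ?_ fun t => hpi h _
    · exact Integrable.of_bound ((measurable_policyGap hφ M π h).comp
        (by fun_prop)).aestronglyMeasurable _ (ae_of_all _ fun t => abs_policyGap_le hφ M π h _)
    · refine Integrable.const_mul (Integrable.of_bound ((measurable_width hφ h).comp
        (by fun_prop)).aestronglyMeasurable 1 (ae_of_all _ fun t => ?_)) _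
      refine (Real.norm_of_nonneg (width_nonneg φ D h _)).trans_le ?_
      exact width_le_one φ D h (hφ' _)
  linarith

end SubOptimality

end PEVI

/-! ### Exponential supermartingale and union bound -/

section Concentration

variable {S A Ω : Type*} [MeasurableSpace S] [MeasurableSpace A] [MeasurableSpace Ω] {H K d : ℕ}

/-- The deviation of the regression target `r + V(x')` from its conditional mean. -/
noncomputable def EpisodicMDP.innovation (M : EpisodicMDP S A H) (h : Fin H) (V : S → ℝ)
    (z : S × A) (y : ℝ × S) : ℝ :=
  y.1 + V y.2 - M.bellman h V z

/-- The logarithm of the exponential supermartingale increment in the direction `v`. -/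
noncomputable def EpisodicMDP.logIncrement (M : EpisodicMDP S A H)
    (φ : S × A → EuclideanSpace ℝ (Fin d)) (h : Fin H) (R : ℝ) (V : S → ℝ) (v : Fin d → ℝ)
    (z : S × A) (y : ℝ × S) : ℝ :=
  (v ⬝ᵥ (φ z).ofLp) * M.innovation h V z y - R ^ 2 / 8 * (v ⬝ᵥ (φ z).ofLp) ^ 2

theorem EpisodicMDP.measurable_logIncrement (M : EpisodicMDP S A H)
    {φ : S × A → EuclideanSpace ℝ (Fin d)} (hφ : Measurable φ) (h : Fin H) (R : ℝ) {V : S → ℝ}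
    (hV : Measurable V) (v : Fin d → ℝ) :
    Measurable (Function.uncurry (M.logIncrement φ h R V v)) := by
  have h1 := PEVI.measurable_feature_apply hφ
  have h2 := M.measurable_bellman h hV
  have h3 : Measurable fun z => v ⬝ᵥ (φ z).ofLp := by
    simp only [dotProduct]; fun_prop
  unfold logIncrement innovation Function.uncurry
  fun_prop

/-- Hoeffding's lemma for the regression noise. -/
theorem EpisodicMDP.lintegral_exp_logIncrement_le (M : EpisodicMDP S A H)
    (φ : S × A → EuclideanSpace ℝ (Fin d)) (h : Fin H) {C : ℝ} {V : S → ℝ}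
    (hV : Measurable V) (hV' : ∀ x, V x ∈ Set.Icc 0 C) (v : Fin d → ℝ) (z : S × A) :
    ∫⁻ y, ENNReal.ofReal (Real.exp (M.logIncrement φ h (1 + C) V v z y)) ∂(M.step h z) ≤ 1 := by
  set t := v ⬝ᵥ (φ z).ofLp with ht
  -- A variable with values in an interval of length `1 + C` has variance proxy `((1 + C)/2)²`,
  -- hence the compensator `(1 + C)² t² / 8`.
  have hsub := hasSubgaussianMGF_of_mem_Icc (μ := M.step h z) (X := fun y => y.1 + V y.2)
    (by fun_prop) (M.reward_add_mem h z hV')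
  have hexp : ∀ y, Real.exp (M.logIncrement φ h (1 + C) V v z y) =
      Real.exp (t * ((y.1 + V y.2) - ∫ y, (y.1 + V y.2) ∂(M.step h z))) *
        Real.exp (-((1 + C) ^ 2 / 8 * t ^ 2)) := fun y => by
    rw [← Real.exp_add]
    rfl
  simp only [hexp]
  rw [← ofReal_integral_eq_lintegral_ofReal ((hsub.integrable_exp_mul t).mul_const _)
    (ae_of_all _ fun y => by positivity), integral_mul_const, ← ENNReal.ofReal_one]
  refine ENNReal.ofReal_le_ofReal ?_
  refine (mul_le_mul_of_nonneg_right (hsub.mgf_le t) (Real.exp_nonneg _)).trans_eq ?_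
  rw [← Real.exp_add, Real.exp_eq_one_iff]
  simp only [sub_zero, NNReal.coe_pow, NNReal.coe_div, coe_nnnorm, NNReal.coe_ofNat, div_pow,
    Real.norm_eq_abs, sq_abs]
  ring

namespace IsCompliant

variable {P : Measure Ω} {M : EpisodicMDP S A H} {D : Ω → OfflineDataset S A H K}

theorem measurable_point (hD : IsCompliant P M D) (τ : Fin K) (h : Fin H) :
    Measurable fun ω => ((D ω).state τ h.castSucc, (D ω).action τ h) :=
  (hD.1 τ h.castSucc).prodMk (hD.2.1 τ h)

theorem measurable_outcome (hD : IsCompliant P M D) (τ : Fin K) (h : Fin H) :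
    Measurable fun ω => ((D ω).reward τ h, (D ω).state τ h.succ) :=
  (hD.2.2.1 τ h).prodMk (hD.1 τ h.succ)

theorem measurable_dataHistory (hD : IsCompliant P M D) (τ : Fin K) (h : Fin H) :
    Measurable fun ω => dataHistory h τ (D ω) :=
  Measurable.prodMk
    (measurable_pi_lambda _ fun j : {j : Fin K // j ≤ τ} => hD.measurable_point j h)
    (measurable_pi_lambda _ fun j : {j : Fin K // j < τ} => hD.measurable_outcome j h)

theorem ae_reward_mem [IsProbabilityMeasure P] (hD : IsCompliant P M D) :
    ∀ᵐ ω ∂P, ∀ τ h, (D ω).reward τ h ∈ Set.Icc (0 : ℝ) 1 := by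
  refine ae_all_iff.2 fun τ => ae_all_iff.2 fun h => ?_
  have hc := hD.2.2.2 h τ
  have h1 : ∀ᵐ q ∂(P.map fun ω => (dataHistory h τ (D ω),
      ((D ω).reward τ h, (D ω).state τ h.succ))), q.2.1 ∈ Set.Icc (0 : ℝ) 1 := by
    rw [hc.map_eq]
    refine Measure.ae_compProd_of_ae_ae (measurableSet_Icc.preimage (by fun_prop)) ?_
    exact ae_of_all _ fun p => M.reward_mem h _
  exact ae_of_ae_map hc.aemeasurable h1

/-- Trajectories are peeled off from the last one: all earlier factors are functions of the history,
and conditionally on it the last factor has integral at most `1`. -/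
theorem lintegral_prod_le_one [IsProbabilityMeasure P] (hD : IsCompliant P M D) (h : Fin H)
    {F : S × A → ℝ × S → ℝ≥0∞} (hF : Measurable (Function.uncurry F))
    (hF1 : ∀ z, ∫⁻ y, F z y ∂(M.step h z) ≤ 1) :
    ∀ (n : ℕ) (hn : n ≤ K),
      ∫⁻ ω, ∏ i : Fin n, F ((D ω).state (Fin.castLE hn i) h.castSucc,
          (D ω).action (Fin.castLE hn i) h)
        ((D ω).reward (Fin.castLE hn i) h, (D ω).state (Fin.castLE hn i) h.succ) ∂P ≤ 1
  | 0, hn => by simp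
  | n + 1, hn => by
    set τ : Fin K := ⟨n, hn⟩ with hτ
    set j : Fin n → {j : Fin K // j < τ} := fun i =>
      ⟨Fin.castLE (Nat.le_of_succ_le hn) i, i.2⟩ with hj
    set G : DataHistory S A τ → ℝ≥0∞ := fun p =>
      ∏ i : Fin n, F (p.1 ⟨(j i).1, (j i).2.le⟩) (p.2 (j i)) with hG
    have hcur := DataHistory.measurable_current (S := S) (A := A) (τ := τ)
    have hGm : Measurable G := by
      refine Finset.measurable_prod _ fun i _ => ?_
      have h1 : Measurable fun p : DataHistory S A τ =>
          (p.1 ⟨(j i).1, (j i).2.le⟩, p.2 (j i)) := by fun_prop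
      exact hF.comp h1
    have hFm : Measurable fun q : DataHistory S A τ × ℝ × S => F q.1.current q.2 :=
      hF.comp ((hcur.comp measurable_fst).prodMk measurable_snd)
    have hGF : Measurable fun q : DataHistory S A τ × ℝ × S => G q.1 * F q.1.current q.2 :=
      (hGm.comp measurable_fst).mul hFm
    have hc := hD.2.2.2 h τ
    have hX := hD.measurable_dataHistory τ h
    calc ∫⁻ ω, ∏ i : Fin (n + 1), F ((D ω).state (Fin.castLE hn i) h.castSucc,
            (D ω).action (Fin.castLE hn i) h)
          ((D ω).reward (Fin.castLE hn i) h, (D ω).state (Fin.castLE hn i) h.succ) ∂P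
        = ∫⁻ ω, (fun q : DataHistory S A τ × ℝ × S => G q.1 * F q.1.current q.2)
            (dataHistory h τ (D ω), ((D ω).reward τ h, (D ω).state τ h.succ)) ∂P := by
          refine lintegral_congr fun ω => ?_
          rw [Fin.prod_univ_castSucc]
          rfl
      _ = ∫⁻ q, G q.1 * F q.1.current q.2 ∂(P.map fun ω => (dataHistory h τ (D ω),
            ((D ω).reward τ h, (D ω).state τ h.succ))) :=
          (lintegral_map hGF (hX.prodMk (hD.measurable_outcome τ h))).symm
      _ = ∫⁻ p, ∫⁻ y, G p * F p.current y ∂(M.step h p.current)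
            ∂(P.map fun ω => dataHistory h τ (D ω)) := by
          have := Measure.isProbabilityMeasure_map (μ := P) hX.aemeasurable
          rw [hc.map_eq, Measure.lintegral_compProd hGF]
          rfl
      _ ≤ ∫⁻ p, G p ∂(P.map fun ω => dataHistory h τ (D ω)) := by
          refine lintegral_mono fun p => ?_
          have h1 : Measurable fun y => F p.current y :=
            hF.comp (measurable_const.prodMk measurable_id)
          rw [lintegral_const_mul _ h1]
          exact mul_le_of_le_one_right' (hF1 _)
      _ = ∫⁻ ω, G (dataHistory h τ (D ω)) ∂P := lintegral_map hGm hX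
      _ ≤ 1 := lintegral_prod_le_one hD h hF hF1 n (Nat.le_of_succ_le hn)

theorem lintegral_exp_sum_le_one [IsProbabilityMeasure P] (hD : IsCompliant P M D) (h : Fin H)
    {ψ : S × A → ℝ × S → ℝ} (hψ : Measurable (Function.uncurry ψ))
    (hψ1 : ∀ z, ∫⁻ y, ENNReal.ofReal (Real.exp (ψ z y)) ∂(M.step h z) ≤ 1) :
    ∫⁻ ω, ENNReal.ofReal (Real.exp (∑ τ, ψ ((D ω).state τ h.castSucc, (D ω).action τ h)
      ((D ω).reward τ h, (D ω).state τ h.succ))) ∂P ≤ 1 := by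
  have := hD.lintegral_prod_le_one h (F := fun z y => ENNReal.ofReal (Real.exp (ψ z y)))
    (hψ.exp.ennreal_ofReal) hψ1 K le_rfl
  refine le_trans (le_of_eq (lintegral_congr fun ω => ?_)) this
  rw [Real.exp_sum, ENNReal.ofReal_prod_of_nonneg fun _ _ => Real.exp_nonneg _]
  rfl

end IsCompliant

theorem measure_log_lt_le_of_lintegral_exp_le_one {P : Measure Ω} {Z : Ω → ℝ} (hZ : Measurable Z)
    (hZ1 : ∫⁻ ω, ENNReal.ofReal (Real.exp (Z ω)) ∂P ≤ 1) {q : ℝ} (hq : 0 < q) :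
    P {ω | Real.log (1 / q) < Z ω} ≤ ENNReal.ofReal q := by
  have h1 := mul_meas_ge_le_lintegral (μ := P) hZ.exp.ennreal_ofReal (ENNReal.ofReal (1 / q))
  have h2 : {ω | Real.log (1 / q) < Z ω} ⊆
      {ω | ENNReal.ofReal (1 / q) ≤ ENNReal.ofReal (Real.exp (Z ω))} := fun ω hω => by
    refine ENNReal.ofReal_le_ofReal ?_
    rw [← Real.exp_log (one_div_pos.2 hq)]
    exact Real.exp_le_exp.2 (le_of_lt hω)
  calc P {ω | Real.log (1 / q) < Z ω}
      ≤ ENNReal.ofReal q * (ENNReal.ofReal (1 / q) *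
          P {ω | ENNReal.ofReal (1 / q) ≤ ENNReal.ofReal (Real.exp (Z ω))}) := by
        rw [← mul_assoc, ← ENNReal.ofReal_mul hq.le, mul_one_div_cancel hq.ne',
          ENNReal.ofReal_one, one_mul]
        exact measure_mono h2
    _ ≤ ENNReal.ofReal q * 1 := by gcongr; exact h1.trans hZ1
    _ = ENNReal.ofReal q := mul_one _

/-- A union bound over finitely many labels, each represented by one of the indices that carry
it. -/
theorem exists_event_forall_exists_le_log {P : Measure Ω} [IsProbabilityMeasure P] {I L : Type*}
    [Fintype L] {Z : I → Ω → ℝ} (hZ : ∀ i, Measurable (Z i))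
    (hZ1 : ∀ i, ∫⁻ ω, ENNReal.ofReal (Real.exp (Z i ω)) ∂P ≤ 1) (label : I → L) {δ : ℝ}
    (hδ : 0 < δ) :
    ∃ E : Set Ω, MeasurableSet E ∧ ENNReal.ofReal (1 - δ) ≤ P E ∧
      ∀ ω ∈ E, ∀ i, ∃ j, label j = label i ∧ Z j ω ≤ Real.log (Fintype.card L / δ) := by
  classical
  -- Only the chosen representative of each label is controlled, so the index type may be
  -- uncountable.
  set B : L → Set Ω := fun l => if hl : ∃ j, label j = l then
    {ω | Real.log (Fintype.card L / δ) < Z hl.choose ω} else ∅ with hB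
  have hBm : ∀ l, MeasurableSet (B l) := fun l => by
    by_cases hl : ∃ j, label j = l
    · simp only [hB, dif_pos hl]
      exact measurableSet_lt measurable_const (hZ _)
    · simp only [hB, dif_neg hl, MeasurableSet.empty]
  have hBP : ∀ l, P (B l) ≤ ENNReal.ofReal (δ / Fintype.card L) := fun l => by
    have hcard : (0 : ℝ) < Fintype.card L := by exact_mod_cast Fintype.card_pos_iff.2 ⟨l⟩
    by_cases hl : ∃ j, label j = l
    · simp only [hB, dif_pos hl]
      have := measure_log_lt_le_of_lintegral_exp_le_one (hZ hl.choose) (hZ1 _)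
        (div_pos hδ hcard)
      rwa [one_div_div] at this
    · simp only [hB, dif_neg hl, measure_empty, zero_le]
  refine ⟨(⋃ l, B l)ᶜ, (MeasurableSet.iUnion hBm).compl, ?_, fun ω hω i => ?_⟩
  · rw [prob_compl_eq_one_sub (MeasurableSet.iUnion hBm), ENNReal.ofReal_sub _ hδ.le,
      ENNReal.ofReal_one]
    refine tsub_le_tsub_left ?_ _
    refine (measure_iUnion_fintype_le P B).trans ((Finset.sum_le_sum fun l _ => hBP l).trans ?_)
    rw [Finset.sum_const, nsmul_eq_mul, Finset.card_univ,
      ← ENNReal.ofReal_natCast, ← ENNReal.ofReal_mul (Nat.cast_nonneg _)]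
    refine ENNReal.ofReal_le_ofReal ?_
    rcases eq_or_ne (Fintype.card L : ℝ) 0 with h0 | h0
    · rw [h0, zero_mul]; exact hδ.le
    · exact (mul_div_cancel₀ δ h0).le
  · have hl : ∃ j, label j = label i := ⟨i, rfl⟩
    refine ⟨hl.choose, hl.choose_spec, ?_⟩
    have h1 : ω ∉ B (label i) := fun h => hω (Set.mem_iUnion.2 ⟨_, h⟩)
    simp only [hB, dif_pos hl, Set.mem_ofPred_eq, not_lt] at h1
    exact h1

end Concentration

/-! ### Rounding bounded parameters -/

theorem exists_label_abs_sub_le {I T : Type*} {f : I → T → ℝ} {R ε : ℝ} (hε : 0 < ε)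
    (hf : ∀ i t, |f i t| ≤ R) {m : ℕ} (hm : 2 * R / ε < m) :
    ∃ label : I → T → Fin m, ∀ i j, label i = label j → ∀ t, |f i t - f j t| ≤ ε := by
  have hnn : ∀ i t, 0 ≤ (f i t + R) / ε := fun i t =>
    div_nonneg (by linarith [(abs_le.1 (hf i t)).1]) hε.le
  have hlt : ∀ i t, ⌊(f i t + R) / ε⌋₊ < m := fun i t => by
    refine (Nat.floor_lt (hnn i t)).2 (lt_of_le_of_lt ?_ hm)
    exact div_le_div_of_nonneg_right (by linarith [(abs_le.1 (hf i t)).2]) hε.le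
  refine ⟨fun i t => ⟨_, hlt i t⟩, fun i j hij t => ?_⟩
  have h1 : ⌊(f i t + R) / ε⌋₊ = ⌊(f j t + R) / ε⌋₊ := congrArg Fin.val (congrFun hij t)
  have h2 := Nat.floor_le (hnn i t)
  have h3 := Nat.lt_floor_add_one ((f i t + R) / ε)
  have h4 := Nat.floor_le (hnn j t)
  have h5 := Nat.lt_floor_add_one ((f j t + R) / ε)
  rw [h1] at h2 h3
  have h6 : |(f i t + R) / ε - (f j t + R) / ε| ≤ 1 := by
    rw [abs_le]; constructor <;> linarith
  rw [← sub_div, add_sub_add_right_eq_sub, abs_div, abs_of_pos hε, div_le_one hε] at h6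
  exact h6

theorem abs_sqrt_sub_sqrt_le {a b δ : ℝ} (h : |a - b| ≤ δ) :
    |Real.sqrt a - Real.sqrt b| ≤ Real.sqrt δ := by
  have key : ∀ a b : ℝ, |a - b| ≤ δ → Real.sqrt a - Real.sqrt b ≤ Real.sqrt δ := fun a b h => by
    have h1 : a ≤ b + δ := by linarith [(abs_le.1 h).2]
    rw [sub_le_iff_le_add']
    rcases le_total 0 b with hb | hb
    · refine Real.sqrt_le_iff.2 ⟨by positivity, h1.trans ?_⟩
      have hδ : 0 ≤ δ := (abs_nonneg _).trans h
      have h2 : Real.sqrt b ^ 2 = b := Real.sq_sqrt hb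
      have h3 : Real.sqrt δ ^ 2 = δ := Real.sq_sqrt hδ
      nlinarith [mul_nonneg (Real.sqrt_nonneg b) (Real.sqrt_nonneg δ)]
    · rw [Real.sqrt_eq_zero_of_nonpos hb, zero_add]
      exact Real.sqrt_le_sqrt (by linarith)
  exact abs_le.2 ⟨by linarith [key b a (by rwa [abs_sub_comm])], key a b h⟩

/-! ### Dependence of the estimated values on finitely many parameters -/

namespace PEVI

section Lipschitz

variable {S A : Type*} {H K d : ℕ}
  {φ : S × A → EuclideanSpace ℝ (Fin d)}

theorem feature_dotProduct_self_le (hφ : ∀ z, ‖φ z‖ ≤ 1) (D : OfflineDataset S A H K) (h : Fin H)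
    (τ : Fin K) : feature φ D h τ ⬝ᵥ feature φ D h τ ≤ 1 :=
  EuclideanSpace.dotProduct_self_le_one (hφ _)

theorem abs_feature_apply_le (hφ : ∀ z, ‖φ z‖ ≤ 1) (z : S × A) (i : Fin d) :
    |(φ z).ofLp i| ≤ 1 :=
  abs_apply_le_of_dotProduct_self_le zero_le_one
    ((EuclideanSpace.dotProduct_self_le_one (hφ z)).trans_eq (one_pow 2).symm) i

theorem abs_weight_apply_le (hφ : ∀ z, ‖φ z‖ ≤ 1) (D : OfflineDataset S A H K) (h : Fin H)
    {V : S → ℝ} {R : ℝ} (hR : 0 ≤ R)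
    (hV : ∀ τ, |D.reward τ h + V (D.state τ h.succ)| ≤ R) (i : Fin d) :
    |weight φ 1 D h V i| ≤ K * R := by
  refine abs_apply_le_of_dotProduct_self_le (by positivity) ?_ i
  refine (inv_gram_mulVec_dotProduct_self_le φ D h _).trans ?_
  refine (sum_smul_dotProduct_self_le Finset.univ hR (feature_dotProduct_self_le hφ D h)
    hV).trans_eq ?_
  simp

/-- Truncation is 1-Lipschitz. The linear part contributes `dε`; the width is the square root of a
quadratic form that moves by at most `d²ε`, hence the term `d√ε`. -/
theorem abs_qStep_sub_le (hφ : ∀ z, ‖φ z‖ ≤ 1) {β ε : ℝ} (hβ : 0 ≤ β)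
    {D D' : OfflineDataset S A H K} {h : Fin H} {V V' : S → ℝ}
    (hw : ∀ i, |weight φ 1 D h V i - weight φ 1 D' h V' i| ≤ ε)
    (hG : ∀ i j, |(gram φ 1 D h)⁻¹ i j - (gram φ 1 D' h)⁻¹ i j| ≤ ε) (z : S × A) :
    |qStep φ 1 β D h V z - qStep φ 1 β D' h V' z| ≤ d * ε + β * (d * Real.sqrt ε) := by
  have hφi := abs_feature_apply_le hφ z
  have h1 : |bellmanHat φ 1 D h V z - bellmanHat φ 1 D' h V' z| ≤ d * ε := by
    rw [bellmanHat, bellmanHat, ← dotProduct_sub]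
    have := abs_dotProduct_le_card_mul hφi (y := weight φ 1 D h V - weight φ 1 D' h V') hw
    simpa using this
  have h2 : |width φ 1 D h z - width φ 1 D' h z| ≤ d * Real.sqrt ε := by
    have h3 : |(φ z).ofLp ⬝ᵥ ((gram φ 1 D h)⁻¹.mulVec (φ z).ofLp) -
        (φ z).ofLp ⬝ᵥ ((gram φ 1 D' h)⁻¹.mulVec (φ z).ofLp)| ≤ d ^ 2 * ε := by
      rw [← dotProduct_sub, ← Matrix.sub_mulVec]
      have h4 : ∀ i, |((gram φ 1 D h)⁻¹ - (gram φ 1 D' h)⁻¹).mulVec (φ z).ofLp i| ≤ d * ε :=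
        fun i => by
          have := abs_dotProduct_le_card_mul
            (x := ((gram φ 1 D h)⁻¹ - (gram φ 1 D' h)⁻¹) i) (hG i) hφi
          rwa [mul_one, Fintype.card_fin] at this
      have := abs_dotProduct_le_card_mul hφi h4
      refine this.trans_eq ?_
      rw [Fintype.card_fin]; ring
    refine (abs_sqrt_sub_sqrt_le h3).trans_eq ?_
    rw [Real.sqrt_mul (by positivity), Real.sqrt_sq (Nat.cast_nonneg _)]
  rw [qStep, qStep]
  refine (abs_max_sub_max_le_abs _ _ _).trans ?_
  refine (abs_min_sub_min_le_max _ _ _ _).trans ?_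
  rw [sub_self, abs_zero, max_eq_left (abs_nonneg _), penalty, penalty]
  have h5 : bellmanHat φ 1 D h V z - β * width φ 1 D h z -
      (bellmanHat φ 1 D' h V' z - β * width φ 1 D' h z) =
      (bellmanHat φ 1 D h V z - bellmanHat φ 1 D' h V' z) -
        β * (width φ 1 D h z - width φ 1 D' h z) := by ring
  rw [h5]
  refine (abs_sub _ _).trans (add_le_add h1 ?_)
  rw [abs_mul, abs_of_nonneg hβ]
  exact mul_le_mul_of_nonneg_left h2 hβ

variable [MeasurableSpace S] [MeasurableSpace A]

/-- Maximizers may differ wildly between nearby Q-functions, but maxima do not: both Q-functions are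
averaged over `π`, and the greedy `π'` does at least as well as `π` in its own Q-function. -/
theorem vHat_castSucc_sub_le (hφ : Measurable φ) (hφ' : ∀ z, ‖φ z‖ ≤ 1) {β ε : ℝ} (hβ : 0 ≤ β)
    {D D' : OfflineDataset S A H K} {π π' : MDPPolicy S A H}
    (hπ' : IsOutput φ 1 β D' π') {h : Fin H}
    (hw : ∀ i, |weight φ 1 D h (vHat φ 1 β D π h.succ) i -
      weight φ 1 D' h (vHat φ 1 β D' π' h.succ) i| ≤ ε)
    (hG : ∀ i j, |(gram φ 1 D h)⁻¹ i j - (gram φ 1 D' h)⁻¹ i j| ≤ ε) (x : S) :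
    vHat φ 1 β D π h.castSucc x - vHat φ 1 β D' π' h.castSucc x ≤
      d * ε + β * (d * Real.sqrt ε) := by
  rw [vHat_castSucc, vHat_castSucc, sub_le_iff_le_add]
  calc ∫ a, qHat φ 1 β D π h (x, a) ∂(π.act h x)
      ≤ ∫ a, (d * ε + β * (d * Real.sqrt ε) + qHat φ 1 β D' π' h (x, a)) ∂(π.act h x) := by
        refine integral_mono (integrable_qHat hφ h x _)
          ((integrable_const _).add (integrable_qHat hφ h x _)) fun a => ?_
        have := (abs_le.1 (abs_qStep_sub_le hφ' hβ hw hG (x, a))).2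
        simp only [qHat]
        linarith
    _ = d * ε + β * (d * Real.sqrt ε) + ∫ a, qHat φ 1 β D' π' h (x, a) ∂(π.act h x) := by
        rw [integral_add (integrable_const _) (integrable_qHat hφ h x _)]
        simp
    _ ≤ _ := add_le_add le_rfl (hπ' h x (π.act h x) inferInstance)

/-- The value functions of the algorithm belong to a family with finitely many bounded real
parameters, in which they depend continuously on the parameters. -/
theorem exists_parameters (hφ : Measurable φ) (hφ' : ∀ z, ‖φ z‖ ≤ 1) {β : ℝ} (hβ : 0 ≤ β)
    (k : Fin (H + 1)) :
    ∃ (w : OfflineDataset S A H K → MDPPolicy S A H → Fin d → ℝ)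
      (G : OfflineDataset S A H K → Fin d × Fin d → ℝ),
      (∀ D π, (∀ τ h, D.reward τ h ∈ Set.Icc (0 : ℝ) 1) → ∀ i, |w D π i| ≤ K * H) ∧
      (∀ D p, |G D p| ≤ 1) ∧
      ∀ D D' π π' ε, 0 ≤ ε → IsOutput φ 1 β D π → IsOutput φ 1 β D' π' →
        (∀ i, |w D π i - w D' π' i| ≤ ε) → (∀ p, |G D p - G D' p| ≤ ε) →
        ∀ x, |vHat φ 1 β D π k x - vHat φ 1 β D' π' k x| ≤ d * ε + β * (d * Real.sqrt ε) := by
  refine Fin.lastCases ?_ (fun h => ?_) k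
  · refine ⟨0, 0, fun _ _ _ _ => by simp; positivity, fun _ _ => by simp, ?_⟩
    intro D D' π π' ε hε _ _ _ _ x
    rw [vHat_last, vHat_last, Pi.zero_apply, sub_zero, abs_zero]
    positivity
  · refine ⟨fun D π => weight φ 1 D h (vHat φ 1 β D π h.succ),
      fun D p => (gram φ 1 D h)⁻¹ p.1 p.2, fun D π hr i => ?_,
      fun D p => abs_inv_gram_apply_le φ D h p.1 p.2, ?_⟩
    · refine abs_weight_apply_le hφ' D h (Nat.cast_nonneg _) (fun τ => ?_) i
      have h1 := vHat_succ_mem (lam := 1) (β := β) (D := D) (π := π) hφ h (D.state τ h.succ)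
      rw [abs_of_nonneg (add_nonneg (hr τ h).1 h1.1)]
      linarith [(hr τ h).2, h1.2]
    · intro D D' π π' ε hε hπ hπ' hw hG x
      refine abs_le.2 ⟨?_, vHat_castSucc_sub_le hφ hφ' hβ hπ' hw (fun i j => hG (i, j)) x⟩
      have := vHat_castSucc_sub_le hφ hφ' hβ hπ (fun i => by rw [abs_sub_comm]; exact hw i)
        (fun i j => by rw [abs_sub_comm]; exact hG (i, j)) x
      linarith

end Lipschitz

end PEVI

/-! ### Regression noise and the ridge estimate -/

section Noise

variable {S A : Type*} [MeasurableSpace S] [MeasurableSpace A] {H K d : ℕ}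
  {φ : S × A → EuclideanSpace ℝ (Fin d)}

namespace EpisodicMDP

theorem abs_bellman_sub_le (M : EpisodicMDP S A H) (h : Fin H) (z : S × A) {V V' : S → ℝ} {C δ : ℝ}
    (hV : Measurable V) (hV' : Measurable V') (hVC : ∀ x, V x ∈ Set.Icc 0 C)
    (hVC' : ∀ x, V' x ∈ Set.Icc 0 C) (hδ : ∀ x, |V x - V' x| ≤ δ) :
    |M.bellman h V z - M.bellman h V' z| ≤ δ := by
  rw [bellman, bellman, ← integral_sub (M.integrable_reward_add h z hV hVC)
    (M.integrable_reward_add h z hV' hVC'), ← Real.norm_eq_abs]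
  refine (norm_integral_le_of_norm_le_const (μ := M.step h z) (C := δ) (ae_of_all _ fun y => ?_)).trans_eq ?_
  · rw [add_sub_add_left_eq_sub]
    exact hδ _
  · rw [probReal_univ, mul_one]

theorem abs_innovation_le (M : EpisodicMDP S A H) (h : Fin H) {V : S → ℝ} {C : ℝ}
    (hV : Measurable V) (hVC : ∀ x, V x ∈ Set.Icc 0 C) (z : S × A) {y : ℝ × S}
    (hy : y.1 ∈ Set.Icc (0 : ℝ) 1) : |M.innovation h V z y| ≤ 1 + C := by
  obtain ⟨h1, h2⟩ := M.bellman_mem h z hV hVC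
  obtain ⟨h3, h4⟩ := hVC y.2
  rw [innovation, abs_le]
  constructor <;> linarith [hy.1, hy.2]

/-- The three terms come from moving `v` in the linear part, moving `V`, and moving `v` in the
quadratic part. The factor in `2 * δ` arises because `V` enters the innovation both at the sample
and in its mean. -/
theorem abs_logIncrement_sub_le (M : EpisodicMDP S A H) (hφ : ∀ z, ‖φ z‖ ≤ 1) (h : Fin H)
    {V V' : S → ℝ} {v v' : Fin d → ℝ} {C δ ε R : ℝ} (hR : 0 ≤ R)
    (hV : Measurable V) (hV' : Measurable V') (hVC : ∀ x, V x ∈ Set.Icc 0 C)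
    (hVC' : ∀ x, V' x ∈ Set.Icc 0 C) (hδ : ∀ x, |V x - V' x| ≤ δ)
    (hv : v ⬝ᵥ v ≤ R ^ 2) (hv' : v' ⬝ᵥ v' ≤ R ^ 2) (hε : ∀ i, |v i - v' i| ≤ ε)
    (z : S × A) {y : ℝ × S} (hy : y.1 ∈ Set.Icc (0 : ℝ) 1) :
    |M.logIncrement φ h (1 + C) V v z y - M.logIncrement φ h (1 + C) V' v' z y| ≤
      d * ε * (1 + C) + R * (2 * δ) + (1 + C) ^ 2 / 8 * (d * ε * (2 * R)) := by
  have hφz : (φ z).ofLp ⬝ᵥ (φ z).ofLp ≤ 1 ^ 2 :=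
    (EuclideanSpace.dotProduct_self_le_one (hφ z)).trans_eq (one_pow 2).symm
  have ha := abs_dotProduct_le_of_le hR zero_le_one hv hφz
  have ha' := abs_dotProduct_le_of_le hR zero_le_one hv' hφz
  have haa : |v ⬝ᵥ (φ z).ofLp - v' ⬝ᵥ (φ z).ofLp| ≤ d * ε := by
    rw [← sub_dotProduct]
    have := abs_dotProduct_le_card_mul (x := v - v') hε (PEVI.abs_feature_apply_le hφ z)
    simpa using this
  have hη := M.abs_innovation_le h hV hVC z hy
  have hηη : |M.innovation h V z y - M.innovation h V' z y| ≤ 2 * δ := by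
    have h1 := abs_le.1 (M.abs_bellman_sub_le h z hV hV' hVC hVC' hδ)
    have h2 := abs_le.1 (hδ y.2)
    rw [innovation, innovation, abs_le]
    constructor <;> linarith [h1.1, h1.2, h2.1, h2.2]
  rw [logIncrement, logIncrement]
  set a := v ⬝ᵥ (φ z).ofLp
  set a' := v' ⬝ᵥ (φ z).ofLp
  set η := M.innovation h V z y
  set η' := M.innovation h V' z y
  rw [mul_one] at ha ha'
  have hdec : a * η - (1 + C) ^ 2 / 8 * a ^ 2 - (a' * η' - (1 + C) ^ 2 / 8 * a' ^ 2) =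
      (a - a') * η + a' * (η - η') - (1 + C) ^ 2 / 8 * ((a - a') * (a + a')) := by ring
  rw [hdec]
  have hdε : 0 ≤ d * ε := (abs_nonneg _).trans haa
  refine (abs_sub _ _).trans (add_le_add ((abs_add_le _ _).trans (add_le_add ?_ ?_)) ?_)
  · rw [abs_mul]; exact mul_le_mul haa hη (abs_nonneg _) hdε
  · rw [abs_mul]; exact mul_le_mul ha' hηη (abs_nonneg _) hR
  · rw [abs_mul, abs_of_nonneg (by positivity), abs_mul]
    refine mul_le_mul_of_nonneg_left (mul_le_mul haa ?_ (abs_nonneg _) hdε) (by positivity)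
    exact (abs_add_le _ _).trans (by linarith)

end EpisodicMDP

namespace PEVI

/-- The feature-weighted sum of the regression noise. -/
noncomputable def noise (M : EpisodicMDP S A H) (φ : S × A → EuclideanSpace ℝ (Fin d))
    (D : OfflineDataset S A H K) (h : Fin H) (V : S → ℝ) : Fin d → ℝ :=
  ∑ τ, M.innovation h V (D.state τ h.castSucc, D.action τ h)
    (D.reward τ h, D.state τ h.succ) • feature φ D h τ

/-- The direction in which the exponential supermartingale detects the noise. -/
noncomputable def noiseDirection (M : EpisodicMDP S A H) (φ : S × A → EuclideanSpace ℝ (Fin d))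
    (D : OfflineDataset S A H K) (h : Fin H) (R : ℝ) (V : S → ℝ) : Fin d → ℝ :=
  (1 / R ^ 2) • (gram φ 1 D h)⁻¹.mulVec (noise M φ D h V)

/-- The squared norm of the noise with respect to the inverse Gram matrix. -/
noncomputable def noiseEnergy (M : EpisodicMDP S A H) (φ : S × A → EuclideanSpace ℝ (Fin d))
    (D : OfflineDataset S A H K) (h : Fin H) (V : S → ℝ) : ℝ :=
  noise M φ D h V ⬝ᵥ (gram φ 1 D h)⁻¹.mulVec (noise M φ D h V)

theorem noiseDirection_dotProduct_self_le (M : EpisodicMDP S A H) (hφ : ∀ z, ‖φ z‖ ≤ 1)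
    (D : OfflineDataset S A H K) (h : Fin H) {V : S → ℝ} {R : ℝ} (hR : 1 ≤ R)
    (hη : ∀ τ, |M.innovation h V (D.state τ h.castSucc, D.action τ h)
      (D.reward τ h, D.state τ h.succ)| ≤ R) :
    noiseDirection M φ D h R V ⬝ᵥ noiseDirection M φ D h R V ≤ (K : ℝ) ^ 2 := by
  have hR0 : 0 < R := by linarith
  have h1 := (inv_gram_mulVec_dotProduct_self_le φ D h (noise M φ D h V)).trans
    (sum_smul_dotProduct_self_le Finset.univ hR0.le (feature_dotProduct_self_le hφ D h) hη)
  rw [Finset.card_univ, Fintype.card_fin] at h1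
  rw [noiseDirection, smul_dotProduct, dotProduct_smul, smul_eq_mul, smul_eq_mul, ← mul_assoc]
  calc 1 / R ^ 2 * (1 / R ^ 2) * _ ≤ 1 / R ^ 2 * (1 / R ^ 2) * (K * R) ^ 2 :=
        mul_le_mul_of_nonneg_left h1 (by positivity)
    _ = (K : ℝ) ^ 2 * (1 / R) ^ 2 := by field_simp
    _ ≤ (K : ℝ) ^ 2 * 1 := by
        gcongr
        exact pow_le_one₀ (by positivity) ((div_le_one hR0).2 hR)
    _ = (K : ℝ) ^ 2 := mul_one _

/-- With `v = Λ⁻¹ s / R²` the linear part equals `N/R²`. Since `Λ` dominates the sum of the `φφᵀ`,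
the quadratic part is at most `(R²/8) vᵀΛv = N/(8R²)`. -/
theorem noiseEnergy_le_sum_logIncrement (M : EpisodicMDP S A H)
    (D : OfflineDataset S A H K) (h : Fin H) (V : S → ℝ) {R : ℝ} (hR : 0 < R) :
    7 / 8 * (noiseEnergy M φ D h V / R ^ 2) ≤
      ∑ τ, M.logIncrement φ h R V (noiseDirection M φ D h R V)
        (D.state τ h.castSucc, D.action τ h) (D.reward τ h, D.state τ h.succ) := by
  set v := noiseDirection M φ D h R V with hv
  set N := noiseEnergy M φ D h V with hN
  have h1 : ∑ τ, (v ⬝ᵥ feature φ D h τ) * M.innovation h V (D.state τ h.castSucc, D.action τ h)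
      (D.reward τ h, D.state τ h.succ) = N / R ^ 2 := by
    have : v ⬝ᵥ noise M φ D h V = N / R ^ 2 := by
      rw [hv, noiseDirection, smul_dotProduct, dotProduct_comm, hN, noiseEnergy, smul_eq_mul]
      ring
    rw [← this, noise, dotProduct_sum]
    exact Finset.sum_congr rfl fun τ _ => by rw [dotProduct_smul, smul_eq_mul, mul_comm]
  have h2 : ∑ τ, (v ⬝ᵥ feature φ D h τ) ^ 2 ≤ N / R ^ 4 := by
    have h3 : v ⬝ᵥ (gram φ 1 D h).mulVec v = N / R ^ 4 := by
      rw [hv, noiseDirection, Matrix.mulVec_smul, gram_mulVec_inv_mulVec, smul_dotProduct,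
        dotProduct_smul, dotProduct_comm, hN, noiseEnergy, smul_eq_mul, smul_eq_mul]
      field_simp
    rw [← h3, dotProduct_gram_mulVec]
    refine le_add_of_le_of_nonneg (Finset.sum_le_sum fun τ _ => ?_) (dotProduct_self_nonneg_real v)
    rw [sq, dotProduct_comm (feature φ D h τ)]
  have h4 : R ^ 2 / 8 * (N / R ^ 4) = 1 / 8 * (N / R ^ 2) := by field_simp
  have h5 := mul_le_mul_of_nonneg_left h2 (by positivity : 0 ≤ R ^ 2 / 8)
  simp only [EpisodicMDP.logIncrement]
  rw [Finset.sum_sub_distrib, ← Finset.mul_sum]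
  change _ ≤ ∑ τ, (v ⬝ᵥ feature φ D h τ) * _ - R ^ 2 / 8 * ∑ τ, (v ⬝ᵥ feature φ D h τ) ^ 2
  rw [h1]
  linarith

/-- The error of the ridge regression estimate of a Bellman update that is linear in the
features. -/
theorem abs_bellmanHat_sub_bellman_le (M : EpisodicMDP S A H) (D : OfflineDataset S A H K)
    (h : Fin H) (V : S → ℝ) {w : EuclideanSpace ℝ (Fin d)}
    (hw : ∀ z, M.bellman h V z = inner ℝ (φ z) w) (z : S × A) :
    |bellmanHat φ 1 D h V z - M.bellman h V z| ≤
      (Real.sqrt (noiseEnergy M φ D h V) + ‖w‖) * width φ 1 D h z := by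
  -- Each target is its mean `φ·w` plus noise, and `∑ φφᵀ = Λ - I`; the subtracted `w` is the ridge
  -- bias.
  have hsum : ∑ τ, (D.reward τ h + V (D.state τ h.succ)) •
      (φ (D.state τ h.castSucc, D.action τ h)).ofLp =
      noise M φ D h V + ((gram φ 1 D h).mulVec w.ofLp - w.ofLp) := by
    have h1 : (gram φ 1 D h).mulVec w.ofLp =
        ∑ τ, (feature φ D h τ ⬝ᵥ w.ofLp) • feature φ D h τ + w.ofLp := by
      refine dotProduct_eq _ _ fun u => ?_
      rw [dotProduct_comm, dotProduct_gram_mulVec, add_dotProduct, sum_dotProduct,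
        dotProduct_comm w.ofLp]
      congr 1
      refine Finset.sum_congr rfl fun τ _ => ?_
      rw [smul_dotProduct, smul_eq_mul, dotProduct_comm u, mul_comm]
    rw [h1, add_sub_cancel_right, noise, ← Finset.sum_add_distrib]
    refine Finset.sum_congr rfl fun τ _ => ?_
    rw [← add_smul, EpisodicMDP.innovation, hw, EuclideanSpace.real_inner_eq_dotProduct]
    simp [feature]
  have hdiff : bellmanHat φ 1 D h V z - M.bellman h V z =
      (φ z).ofLp ⬝ᵥ (gram φ 1 D h)⁻¹.mulVec (noise M φ D h V) -
        (φ z).ofLp ⬝ᵥ (gram φ 1 D h)⁻¹.mulVec w.ofLp := by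
    rw [bellmanHat, weight, hsum, Matrix.mulVec_add, Matrix.mulVec_sub,
      inv_gram_mulVec_gram_mulVec, hw, EuclideanSpace.real_inner_eq_dotProduct,
      dotProduct_add, dotProduct_sub]
    ring
  have h1 := abs_dotProduct_inv_gram_le φ D h (φ z).ofLp (noise M φ D h V)
  have h2 := abs_dotProduct_inv_gram_le φ D h (φ z).ofLp w.ofLp
  have h3 : Real.sqrt (w.ofLp ⬝ᵥ (gram φ 1 D h)⁻¹.mulVec w.ofLp) ≤ ‖w‖ := by
    refine Real.sqrt_le_iff.2 ⟨norm_nonneg _, (dotProduct_inv_gram_le φ D h _).trans_eq ?_⟩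
    exact EuclideanSpace.dotProduct_self_eq_norm_sq w
  rw [hdiff]
  refine (abs_sub _ _).trans ((add_le_add h1 (h2.trans
    (mul_le_mul_of_nonneg_left h3 (Real.sqrt_nonneg _)))).trans_eq ?_)
  rw [← mul_add, mul_comm]
  rfl

end PEVI

end Noise

/-! ### Choice of the constants -/

section Numerics

variable {d H K : ℕ} {ξ Q : ℝ}

theorem pow_mul_inv_pow_add {Q : ℝ} (hQ : 0 < Q) (a b : ℕ) :
    Q ^ a * (1 / Q ^ (a + b)) = 1 / Q ^ b := by
  rw [pow_add]; field_simp

theorem two_mul_div_bounds (hd : 1 ≤ d) (hH : 1 ≤ H) (hK : 1 ≤ K) (hξ : ξ ∈ Set.Ioo (0 : ℝ) 1)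
    (hQ : Q = 2 * d * H * K / ξ) :
    2 ≤ Q ∧ (d * H * K : ℝ) ≤ Q ∧ H / ξ ≤ Q ∧ 1 / 2 ≤ Real.log Q ∧ Real.log Q ≤ Q := by
  have hd' : (1 : ℝ) ≤ d := by exact_mod_cast hd
  have hH' : (1 : ℝ) ≤ H := by exact_mod_cast hH
  have hK' : (1 : ℝ) ≤ K := by exact_mod_cast hK
  have hdK : (1 : ℝ) ≤ d * K := one_le_mul_of_one_le_of_one_le hd' hK'
  have hdHK : (1 : ℝ) ≤ d * H * K :=
    one_le_mul_of_one_le_of_one_le (one_le_mul_of_one_le_of_one_le hd' hH') hK'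
  have h1 : 2 * (d * H * K : ℝ) ≤ Q := by
    rw [hQ, le_div_iff₀ hξ.1]
    nlinarith [hξ.2]
  have h2 : 2 ≤ Q := by linarith
  refine ⟨h2, by linarith, ?_, ?_, ?_⟩
  · rw [hQ]
    refine div_le_div_of_nonneg_right ?_ hξ.1.le
    nlinarith
  · refine le_trans ?_ (Real.log_le_log (by norm_num) h2)
    linarith [Real.log_two_gt_d9]
  · linarith [Real.log_le_sub_one_of_pos (by linarith : 0 < Q)]

/-- The exponent `32` is dictated by the width: after the square root only `1 / Q ^ 16` is left to
beat `β d K² ≤ Q ^ 10`. -/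
theorem discretization_error_le_one {β : ℝ} (hd : 1 ≤ d) (hH : 1 ≤ H) (hK : 1 ≤ K) (hQ2 : 2 ≤ Q)
    (hQ : (d * H * K : ℝ) ≤ Q) (hβ : β ≤ Q ^ 8) :
    K * (d * (1 / Q ^ 32) * H + K * (2 * (d * (1 / Q ^ 32) + β * (d * Real.sqrt (1 / Q ^ 32)))) +
      (H : ℝ) ^ 2 / 8 * (d * (1 / Q ^ 32) * (2 * K))) ≤ 1 := by
  have hd' : (1 : ℝ) ≤ d := by exact_mod_cast hd
  have hH' : (1 : ℝ) ≤ H := by exact_mod_cast hH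
  have hK' : (1 : ℝ) ≤ K := by exact_mod_cast hK
  have hQ0 : 0 < Q := by linarith
  have hsqrt : Real.sqrt (1 / Q ^ 32) = 1 / Q ^ 16 := by
    rw [show (1 / Q ^ 32 : ℝ) = (1 / Q ^ 16) ^ 2 by rw [div_pow, one_pow, ← pow_mul]]
    exact Real.sqrt_sq (by positivity)
  have hdK : (d * K : ℝ) ≤ Q := by
    refine le_trans (le_mul_of_one_le_right (by positivity) hH') (le_trans (le_of_eq ?_) hQ)
    ring
  have hKQ : (K : ℝ) ≤ Q := (le_mul_of_one_le_left (by positivity) hd').trans hdK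
  have hHK : (H * K : ℝ) ≤ Q := by
    refine le_trans (le_mul_of_one_le_left (by positivity) hd') (le_trans (le_of_eq ?_) hQ)
    ring
  have hsmall : ∀ n : ℕ, 1 / Q ^ (n + 3) ≤ 1 / 8 := fun n => by
    refine one_div_le_one_div_of_le (by norm_num) ?_
    calc (8 : ℝ) = 2 ^ 3 := by norm_num
      _ ≤ Q ^ 3 := by gcongr
      _ ≤ Q ^ (n + 3) := pow_le_pow_right₀ (by linarith) (by omega)
  have hdKK : (d * K * K : ℝ) ≤ Q ^ 2 := by
    rw [sq]; exact mul_le_mul hdK hKQ (by positivity) hQ0.le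
  have t1 : K * (d * (1 / Q ^ 32) * H) ≤ 1 / 8 := by
    calc K * (d * (1 / Q ^ 32) * H) = d * H * K * (1 / Q ^ 32) := by ring
      _ ≤ Q ^ 1 * (1 / Q ^ (1 + 31)) := by rw [pow_one]; gcongr
      _ = 1 / Q ^ 31 := pow_mul_inv_pow_add hQ0 1 31
      _ ≤ 1 / 8 := hsmall 28
  have t2 : (K : ℝ) * (K * (d * (1 / Q ^ 32))) ≤ 1 / 8 := by
    calc (K : ℝ) * (K * (d * (1 / Q ^ 32))) = d * K * K * (1 / Q ^ 32) := by ring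
      _ ≤ Q ^ 2 * (1 / Q ^ (2 + 30)) := by gcongr
      _ = 1 / Q ^ 30 := pow_mul_inv_pow_add hQ0 2 30
      _ ≤ 1 / 8 := hsmall 27
  have t3 : (K : ℝ) * (K * (β * (d * (1 / Q ^ 16)))) ≤ 1 / 8 := by
    calc (K : ℝ) * (K * (β * (d * (1 / Q ^ 16)))) = β * (d * K * K) * (1 / Q ^ 16) := by ring
      _ ≤ Q ^ 8 * Q ^ 2 * (1 / Q ^ (10 + 6)) := by gcongr
      _ = Q ^ 10 * (1 / Q ^ (10 + 6)) := by rw [← pow_add]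
      _ = 1 / Q ^ 6 := pow_mul_inv_pow_add hQ0 10 6
      _ ≤ 1 / 8 := hsmall 3
  have t4 : (K : ℝ) * ((H : ℝ) ^ 2 * (d * (1 / Q ^ 32) * K)) ≤ 1 / 8 := by
    calc (K : ℝ) * ((H : ℝ) ^ 2 * (d * (1 / Q ^ 32) * K))
        = (d * H * K) * (H * K) * (1 / Q ^ 32) := by ring
      _ ≤ Q * Q * (1 / Q ^ (2 + 30)) := by gcongr
      _ = Q ^ 2 * (1 / Q ^ (2 + 30)) := by rw [sq]
      _ = 1 / Q ^ 30 := pow_mul_inv_pow_add hQ0 2 30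
      _ ≤ 1 / 8 := hsmall 27
  rw [hsqrt]
  nlinarith

theorem exists_resolution (hQ2 : 2 ≤ Q) {R : ℝ} (hR : 0 ≤ R) (hRQ : R ≤ Q) :
    ∃ m : ℕ, 2 * R / (1 / Q ^ 32) < m ∧ (m : ℝ) ≤ Q ^ 35 := by
  have hQ0 : 0 < Q := by linarith
  refine ⟨⌊2 * R / (1 / Q ^ 32)⌋₊ + 1, by exact_mod_cast Nat.lt_floor_add_one _, ?_⟩
  push_cast
  have h1 := Nat.floor_le (show 0 ≤ 2 * R / (1 / Q ^ 32) by positivity)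
  have h2 : 2 * R / (1 / Q ^ 32) ≤ Q ^ 34 := by
    rw [div_div_eq_mul_div, div_one]
    calc 2 * R * Q ^ 32 ≤ Q * Q * Q ^ 32 := by gcongr
      _ = Q ^ 34 := by ring
  have h3 : (1 : ℝ) ≤ Q ^ 34 := one_le_pow₀ (by linarith)
  have h4 : Q ^ 34 * 2 ≤ Q ^ 34 * Q := by gcongr
  calc _ ≤ Q ^ 34 * Q := by linarith
    _ = Q ^ 35 := by ring

/-- `H / ξ` contributes one `log Q`, and `d + (d² + d) ≤ 3d²` coordinates contribute `35 log Q`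
each: `106 = 1 + 3 · 35`. -/
theorem log_card_div_le (hd : 1 ≤ d) (hQ2 : 2 ≤ Q) (hH : 0 < H / ξ) (hHQ : H / ξ ≤ Q) {m : ℕ}
    (hm0 : 0 < m) (hm : (m : ℝ) ≤ Q ^ 35) :
    Real.log ((H * m ^ (d + (d * d + d)) : ℝ) / ξ) ≤ 106 * d ^ 2 * Real.log Q := by
  have hQ0 : 0 < Q := by linarith
  have hm0' : (0 : ℝ) < m := by exact_mod_cast hm0
  have hlog : 0 ≤ Real.log Q := Real.log_nonneg (by linarith)
  have hd' : (1 : ℝ) ≤ d := by exact_mod_cast hd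
  rw [mul_div_right_comm, Real.log_mul hH.ne' (by positivity), Real.log_pow]
  have h1 := Real.log_le_log hH hHQ
  have h2 := Real.log_le_log hm0' hm
  rw [Real.log_pow] at h2
  push_cast at h2 ⊢
  have h3 : ((d : ℝ) + (d * d + d)) * Real.log m ≤ ((d : ℝ) + (d * d + d)) * (35 * Real.log Q) := by
    gcongr
  have h4 : 1 + ((d : ℝ) + (d * d + d)) * 35 ≤ 106 * d ^ 2 := by nlinarith
  have h5 := mul_le_mul_of_nonneg_right h4 hlog
  linarith

theorem sqrt_energy_add_le {ι N : ℝ} (hd : 1 ≤ d) (hH : 1 ≤ H) (hι : 1 / 2 ≤ ι)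
    (hN : 7 / 8 * (N / (H : ℝ) ^ 2) ≤ 106 * d ^ 2 * ι + 1) :
    Real.sqrt N + H * Real.sqrt d ≤ 64 * d * H * Real.sqrt ι := by
  have hd' : (1 : ℝ) ≤ d := by exact_mod_cast hd
  have hH' : (1 : ℝ) ≤ H := by exact_mod_cast hH
  have hs : 1 / 2 ≤ Real.sqrt ι := Real.le_sqrt_of_sq_le (by linarith)
  have hs2 : Real.sqrt ι ^ 2 = ι := Real.sq_sqrt (by linarith)
  have h1 : Real.sqrt N ≤ 12 * d * H * Real.sqrt ι := by
    refine Real.sqrt_le_iff.2 ⟨by positivity, ?_⟩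
    have h2 : 1 ≤ 2 * (d : ℝ) ^ 2 * ι := by nlinarith [one_le_pow₀ hd' (n := 2)]
    have h3 : N / (H : ℝ) ^ 2 ≤ 144 * d ^ 2 * ι := by nlinarith
    rw [div_le_iff₀ (by positivity)] at h3
    calc N ≤ 144 * d ^ 2 * ι * H ^ 2 := h3
      _ = (12 * d * H * Real.sqrt ι) ^ 2 := by rw [mul_pow, hs2]; ring
  have h4 : Real.sqrt d ≤ d := Real.sqrt_le_iff.2 ⟨by linarith, by nlinarith⟩
  have h5 : H * Real.sqrt d ≤ H * d * (2 * Real.sqrt ι) := by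
    calc H * Real.sqrt d ≤ H * d := by gcongr
      _ ≤ H * d * (2 * Real.sqrt ι) := le_mul_of_one_le_right (by positivity) (by linarith)
  have h6 : 0 ≤ (d : ℝ) * H * Real.sqrt ι := by positivity
  linarith

theorem beta_le_pow (hd : 1 ≤ d) (hH : 1 ≤ H) (hK : 1 ≤ K) (hQ2 : 2 ≤ Q)
    (hQ : (d * H * K : ℝ) ≤ Q) (hlog : Real.log Q ≤ Q) :
    64 * d * H * Real.sqrt (Real.log Q) ≤ Q ^ 8 := by
  have hK' : (1 : ℝ) ≤ K := by exact_mod_cast hK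
  have h1 : Real.sqrt (Real.log Q) ≤ Q := Real.sqrt_le_iff.2 ⟨by linarith, by nlinarith⟩
  have h2 : (d * H : ℝ) ≤ Q := le_trans (le_mul_of_one_le_right (by positivity) hK') hQ
  have h3 : (64 : ℝ) ≤ Q ^ 6 := by
    calc (64 : ℝ) = 2 ^ 6 := by norm_num
      _ ≤ Q ^ 6 := by gcongr
  calc 64 * d * H * Real.sqrt (Real.log Q) = 64 * (d * H) * Real.sqrt (Real.log Q) := by ring
    _ ≤ Q ^ 6 * Q * Q := by gcongr
    _ = Q ^ 8 := by ring

end Numerics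

/-! ### The uncertainty quantifier and the main theorem -/

/-- In dimension `0` the transition probabilities would have total mass `0`. -/
theorem EpisodicMDP.IsLinear.one_le_dim {S A : Type*} [MeasurableSpace S] [MeasurableSpace A]
    {H d : ℕ} {M : EpisodicMDP S A H} {φ : S × A → EuclideanSpace ℝ (Fin d)} (hM : M.IsLinear φ)
    (h : Fin H) (z : S × A) : 1 ≤ d := by
  obtain ⟨_, μ, θ, hμθ⟩ := hM
  have hP := (hμθ h).2.2.1 z Set.univ MeasurableSet.univ
  have : IsMarkovKernel (M.transition h) := by unfold EpisodicMDP.transition; infer_instance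
  rw [probReal_univ] at hP
  by_contra hd
  obtain rfl : d = 0 := by omega
  rw [Subsingleton.elim (φ z) 0, inner_zero_left] at hP
  exact one_ne_zero hP

theorem PEVI.isUncertaintyQuantifier_penalty {S A Ω : Type*} [MeasurableSpace S]
    [MeasurableSpace A] [MeasurableSpace Ω] {H K d : ℕ} (hK : 0 < K) {ξ : ℝ}
    (hξ : ξ ∈ Set.Ioo (0 : ℝ) 1) {φ : S × A → EuclideanSpace ℝ (Fin d)} (hφ : Measurable φ)
    {M : EpisodicMDP S A H} (hM : M.IsLinear φ) {P : Measure Ω} [IsProbabilityMeasure P]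
    {D : Ω → OfflineDataset S A H K} (hD : IsCompliant P M D) {β : ℝ}
    (hβ : β = 64 * d * H * Real.sqrt (Real.log (2 * d * H * K / ξ)))
    {π : Ω → MDPPolicy S A H} (hπ : ∀ ω, IsOutput φ 1 β (D ω) (π ω)) :
    IsUncertaintyQuantifier P ξ
      (fun ω (h : Fin H) => bellmanHat φ 1 (D ω) h (vHat φ 1 β (D ω) (π ω) h.succ))
      (fun ω (h : Fin H) => M.bellman h (vHat φ 1 β (D ω) (π ω) h.succ))
      (fun ω (h : Fin H) => penalty φ 1 β (D ω) h) := by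
  rcases Nat.eq_zero_or_pos H with rfl | hH
  · exact ⟨Set.univ, fun ω _ h => h.elim0, MeasurableSet.univ, by
      rw [measure_univ, ENNReal.ofReal_le_one]; linarith [hξ.1]⟩
  -- The state-action pair needed here is a data point, which exists because `0 < K` and `0 < H`.
  have hd : 1 ≤ d := by
    obtain ⟨ω⟩ : Nonempty Ω := nonempty_of_isProbabilityMeasure P
    exact hM.one_le_dim ⟨0, hH⟩ ((D ω).state ⟨0, hK⟩ 0, (D ω).action ⟨0, hK⟩ ⟨0, hH⟩)
  have hφ' := hM.1
  have hH1 : (1 : ℝ) ≤ H := by exact_mod_cast hH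
  have hK1 : (1 : ℝ) ≤ K := by exact_mod_cast hK
  have hd1 : (1 : ℝ) ≤ d := by exact_mod_cast hd
  have hβ0 : 0 ≤ β := by rw [hβ]; positivity
  obtain ⟨Q, hQ⟩ : ∃ Q : ℝ, Q = 2 * d * H * K / ξ := ⟨_, rfl⟩
  rw [← hQ] at hβ
  obtain ⟨hQ2, hdHK, hHξ, hι, hιQ⟩ := two_mul_div_bounds hd hH hK hξ hQ
  have hβQ : β ≤ Q ^ 8 := hβ ▸ beta_le_pow hd hH hK hQ2 hdHK hιQ
  have hKHQ : (K * H : ℝ) ≤ Q := by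
    refine le_trans (le_mul_of_one_le_left (by positivity) hd1) (le_trans (le_of_eq ?_) hdHK)
    ring
  have hKH1 : (1 : ℝ) ≤ K * H := one_le_mul_of_one_le_of_one_le hK1 hH1
  have hε : (0 : ℝ) < 1 / Q ^ 32 := by positivity
  have hRC : 1 + ((H : ℝ) - 1) = H := by ring
  set V : Fin H → Ω → S → ℝ := fun h ω => vHat φ 1 β (D ω) (π ω) h.succ with hV
  have hVm : ∀ h ω, Measurable (V h ω) := fun h ω => measurable_vHat hφ _
  have hVC : ∀ h ω x, V h ω x ∈ Set.Icc 0 ((H : ℝ) - 1) := fun h ω => vHat_succ_mem hφ h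
  -- An index is a step together with a frozen outcome; the outcome supplies a deterministic value
  -- function and direction, tested in `Z` on independently varying data `ω`.
  set I := Fin H × {ω : Ω // ∀ τ h, (D ω).reward τ h ∈ Set.Icc (0 : ℝ) 1}
  set v : Fin H → Ω → Fin d → ℝ := fun h ω => noiseDirection M φ (D ω) h H (V h ω) with hv
  have hvv : ∀ i : I, v i.1 i.2 ⬝ᵥ v i.1 i.2 ≤ (K : ℝ) ^ 2 := fun i => by
    refine noiseDirection_dotProduct_self_le M hφ' (D i.2) i.1 hH1 fun τ => ?_
    have := M.abs_innovation_le i.1 (hVm i.1 i.2) (hVC i.1 i.2)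
      ((D i.2).state τ i.1.castSucc, (D i.2).action τ i.1)
      (y := ((D i.2).reward τ i.1, (D i.2).state τ i.1.succ)) (i.2.2 τ i.1)
    rwa [hRC] at this
  set Z : I → Ω → ℝ := fun i ω => ∑ τ, M.logIncrement φ i.1 H (V i.1 i.2) (v i.1 i.2)
    ((D ω).state τ i.1.castSucc, (D ω).action τ i.1)
    ((D ω).reward τ i.1, (D ω).state τ i.1.succ) with hZ
  have hψm : ∀ i : I, Measurable (Function.uncurry
      (M.logIncrement φ i.1 H (V i.1 i.2) (v i.1 i.2))) := fun i =>
    M.measurable_logIncrement hφ i.1 H (hVm _ _) _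
  have hZm : ∀ i, Measurable (Z i) := fun i => Finset.measurable_sum _ fun τ _ =>
    (hψm i).comp ((hD.measurable_point τ i.1).prodMk (hD.measurable_outcome τ i.1))
  have hZ1 : ∀ i, ∫⁻ ω, ENNReal.ofReal (Real.exp (Z i ω)) ∂P ≤ 1 := fun i => by
    refine hD.lintegral_exp_sum_le_one i.1 (hψm i) fun z => ?_
    have := M.lintegral_exp_logIncrement_le φ i.1 (hVm i.1 i.2) (hVC i.1 i.2) (v i.1 i.2) z
    rwa [hRC] at this
  choose w G hw hG hlip using fun h : Fin H => exists_parameters (K := K) hφ hφ' hβ0 h.succ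
  set f : I → Fin d ⊕ (Fin d × Fin d) ⊕ Fin d → ℝ := fun i =>
    Sum.elim (w i.1 (D i.2) (π i.2)) (Sum.elim (G i.1 (D i.2)) (v i.1 i.2)) with hf
  have hfR : ∀ i t, |f i t| ≤ K * H := by
    rintro i (t | t | t)
    · exact hw i.1 _ _ i.2.2 t
    · exact (hG i.1 _ t).trans hKH1
    · exact (abs_apply_le_of_dotProduct_self_le (by positivity) (hvv i) t).trans
        (le_mul_of_one_le_right (by positivity) hH1)
  obtain ⟨m, hm, hmQ⟩ := exists_resolution hQ2 (by positivity : (0 : ℝ) ≤ K * H) hKHQ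
  obtain ⟨label, hlabel⟩ := exists_label_abs_sub_le hε hfR hm
  have hm0 : 0 < m := by
    have : (0 : ℝ) < m := lt_of_le_of_lt (by positivity) hm
    exact_mod_cast this
  -- The step is part of the label, so a representative belongs to the same `h`; this is the factor
  -- `H` in the number of labels.
  obtain ⟨E, hE, hPE, hEZ⟩ := exists_event_forall_exists_le_log hZm hZ1
    (fun i => (i.1, label i)) hξ.1
  obtain ⟨s, hs, hsm, hsr⟩ := hD.ae_reward_mem.exists_measurable_mem
  refine ⟨E ∩ s, ?_, hE.inter hsm, ?_⟩
  swap
  · rwa [measure_congr (inter_ae_eq_left_of_ae_eq_univ (Filter.eventuallyEq_univ.2 hs))]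
  rintro ω ⟨hωE, hωs⟩ h z
  obtain ⟨⟨h', ω'⟩, hlab, hZj⟩ := hEZ ω hωE (h, ⟨ω, hsr ω hωs⟩)
  obtain ⟨rfl, hlab'⟩ := Prod.ext_iff.1 hlab
  have hclose := hlabel _ _ hlab'.symm
  have hδ := hlip h' (D ω) (D ω') (π ω) (π ω') (1 / Q ^ 32) hε.le (hπ ω) (hπ ω')
    (fun t => hclose (Sum.inl t)) (fun t => hclose (Sum.inr (Sum.inl t)))
  -- Both exponents are evaluated on the actual data `ω`; only the value function and the direction
  -- are exchanged for those of `ω'`.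
  have hcomp : Z (h', ⟨ω, hsr ω hωs⟩) ω - Z (h', ω') ω ≤ 1 := by
    refine le_trans ?_ (discretization_error_le_one hd hH hK hQ2 hdHK hβQ)
    simp only [hZ]
    rw [← Finset.sum_sub_distrib]
    refine (Finset.sum_le_card_nsmul _ _ _ fun τ _ => (le_abs_self _).trans ?_).trans_eq
      (by rw [Finset.card_univ, Fintype.card_fin, nsmul_eq_mul])
    have := M.abs_logIncrement_sub_le hφ' h' (R := K) (by positivity) (hVm h' ω) (hVm h' ω')
      (hVC h' ω) (hVC h' ω') hδ (hvv (h', ⟨ω, hsr ω hωs⟩)) (hvv (h', ω'))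
      (fun t => hclose (Sum.inr (Sum.inr t)))
      ((D ω).state τ h'.castSucc, (D ω).action τ h')
      (y := ((D ω).reward τ h', (D ω).state τ h'.succ)) (hsr ω hωs τ h')
    rwa [hRC] at this
  have hL : Real.log (Fintype.card (Fin H × (Fin d ⊕ (Fin d × Fin d) ⊕ Fin d → Fin m)) / ξ) ≤
      106 * d ^ 2 * Real.log Q := by
    have := log_card_div_le hd hQ2 (div_pos (by linarith) hξ.1) hHξ hm0 hmQ
    simpa using this
  have henergy := noiseEnergy_le_sum_logIncrement (φ := φ) M (D ω) h' (V h' ω)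
    (by linarith : (0 : ℝ) < H)
  obtain ⟨u, hu, hBu⟩ := hM.exists_bellman_eq_inner h' (by linarith : (0 : ℝ) ≤ (H : ℝ) - 1)
    (hVm h' ω) (hVC h' ω)
  rw [hRC] at hu
  refine (abs_bellmanHat_sub_bellman_le M (D ω) h' (V h' ω) hBu z).trans ?_
  refine mul_le_mul_of_nonneg_right ?_ (width_nonneg φ (D ω) h' z)
  rw [hβ]
  refine le_trans (add_le_add le_rfl hu) (sqrt_energy_add_le hd hH hι ?_)
  change _ ≤ Z (h', ⟨ω, hsr ω hωs⟩) ω at henergy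
  linarith

theorem mainTheorem1 :
    ∃ c : ℝ, 0 < c ∧
      ∀ {S A Ω : Type*} [MeasurableSpace S] [MeasurableSpace A] [MeasurableSpace Ω]
        (H K d : ℕ) (_ : 0 < K) (ξ : ℝ) (_ : ξ ∈ Set.Ioo (0 : ℝ) 1)
        (φ : S × A → EuclideanSpace ℝ (Fin d)) (_ : Measurable φ)
        (M : EpisodicMDP S A H) (_ : M.IsLinear φ)
        (P : Measure Ω) (_ : IsProbabilityMeasure P)
        (D : Ω → OfflineDataset S A H K) (_ : IsCompliant P M D)
        (β : ℝ) (_ : β = c * d * H * Real.sqrt (Real.log (2 * d * H * K / ξ)))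
        (pess : OfflineDataset S A H K → MDPPolicy S A H)
        (_ : ∀ ω, PEVI.IsOutput φ 1 β (D ω) (pess (D ω))),
        let Vhat := fun ω => PEVI.vHat φ 1 β (D ω) (pess (D ω))
        let Bhat := fun ω (h : Fin H) => PEVI.bellmanHat φ 1 (D ω) h (Vhat ω h.succ)
        let B := fun ω (h : Fin H) => M.bellman h (Vhat ω h.succ)
        let Γ := fun ω (h : Fin H) => PEVI.penalty φ 1 β (D ω) h
        IsUncertaintyQuantifier P ξ Bhat B Γ ∧
        ∀ ω ∈ accuracyEvent Bhat B Γ, ∀ πstar : MDPPolicy S A H, M.IsOptimal πstar → ∀ x : S,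
          M.subOpt πstar (pess (D ω)) x ≤
            2 * β * ∑ h : Fin H, M.expectSA πstar x h (PEVI.width φ 1 (D ω) h) := by
  refine ⟨64, by norm_num, ?_⟩
  intro S A Ω _ _ _ H K d hK ξ hξ φ hφ M hM P _ D hD β hβ pess hpess Vhat Bhat B Γ
  refine ⟨PEVI.isUncertaintyQuantifier_penalty hK hξ hφ hM hD hβ hpess,
    fun ω hω πstar _ x => ?_⟩
  have hβ0 : 0 ≤ β := by rw [hβ]; positivity
  exact PEVI.value_sub_value_le hφ hM.1 M hβ0 (hpess ω) hω πstar x
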